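/- A rooted tree is a finite tree with a distinguished vertex (the root); trees are counted unlabelled, i.e. up to isomorphisms preserving the root. A leaf is a non-root vertex of valence one; the root is a leaf only if it is the only vertex. Write $\mathrm{even}^*$ for the number of non-leaf vertices at odd distance from the root, and $\mathrm{odd}^*$ for the number of non-leaf vertices at even non-zero distance from the root. For an integer $d\ge 1$ put $N_d=\frac{(d-1)(d-2)}2+1$ if $d$ is odd and $N_d=\frac{(d-1)(d-2)}2+2$ if $d$ is even, and let $k=\lceil d/2\rceil$. Let $A_d$ be the number of rooted unlabelled trees with at most $N_d$ vertices which satisfy both Arnold inequalities $$\mathrm{even}^*\le\frac{(k-1)(k-2)}2,\qquad \mathrm{odd}^*\le\frac{(k-1)(k-2)}2 .$$ (For even $d=2k$ these are the inequalities for degree $d$; for odd $d$ they are the inequalities for degree $d+1$.) Let $a_{n,m}$ be the number of rooted unlabelled trees with $n$ vertices and $m$ leaves. For $\zeta>0$ let $r(\zeta)$ be the supremum of those $x\ge 0$ for which $\sum_{n,m}a_{n,m}x^n\zeta^m$ converges, and let $x_0=\sup_{\zeta>0} r(\zeta)\sqrt{\zeta}$ and $C_1=1/x_0$. **Theorem 13.**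 $C_1=2.9193800\ldots$ (that is, $2.9193800\le C_1<2.9193801$), and $A_d$ is exponentially equivalent to $C_1^{d^2/2}$, i.e. $$\log A_d\sim\frac{d^2}{2}\log C_1\qquad(d\to\infty).$$ -/

import Mathlib

open Filter Asymptotics

namespace PlaneTrees

/-- A rooted tree whose vertices are labelled by `Fin n`: a tree (connected acyclic graph) with a
distinguished vertex. -/
structure LabelledRootedTree (n : ℕ) where
  /-- the underlying graph -/
  graph : SimpleGraph (Fin n)
  /-- the distinguished vertex -/
  root : Fin n
  /-- the graph is a tree -/
  isTree : graph.IsTree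

namespace LabelledRootedTree

variable {n : ℕ}

/-- Two rooted trees are isomorphic if some graph isomorphism takes the root to the root. -/
instance isoSetoid (n : ℕ) : Setoid (LabelledRootedTree n) where
  r s t := ∃ e : s.graph ≃g t.graph, e s.root = t.root
  iseqv :=
    { refl := fun _ => ⟨SimpleGraph.Iso.refl, rfl⟩
      symm := fun ⟨e, he⟩ => ⟨e.symm, by rw [← he]; exact e.symm_apply_apply _⟩
      trans := fun ⟨e, he⟩ ⟨f, hf⟩ => ⟨e.trans f, by
        rw [← hf, ← he]; rfl⟩ }

/-- The multiplicity (valence) of a vertex. -/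
noncomputable def valence (t : LabelledRootedTree n) (v : Fin n) : ℕ :=
  (t.graph.neighborSet v).ncard

/-- Leaves: vertices of valence one other than the root; the root is a leaf exactly when the tree
has no other vertices. -/
def IsLeaf (t : LabelledRootedTree n) (v : Fin n) : Prop :=
  (v ≠ t.root ∧ t.valence v = 1) ∨ (v = t.root ∧ ∀ w : Fin n, w = t.root)

/-- The number of leaves. -/
noncomputable def numLeaves (t : LabelledRootedTree n) : ℕ :=
  {v : Fin n | t.IsLeaf v}.ncard

/-- `even*`: the number of non-leaf vertices at odd distance from the root. -/
noncomputable def evenStar (t : LabelledRootedTree n) : ℕ :=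
  {v : Fin n | ¬ t.IsLeaf v ∧ Odd (t.graph.dist t.root v)}.ncard

/-- `odd*`: the number of non-leaf vertices at even non-zero distance from the root. -/
noncomputable def oddStar (t : LabelledRootedTree n) : ℕ :=
  {v : Fin n | ¬ t.IsLeaf v ∧ Even (t.graph.dist t.root v) ∧ t.graph.dist t.root v ≠ 0}.ncard

/-- The two Arnold inequalities for the parameter `k` (that is, for the even degree `2 * k`). -/
def SatisfiesArnold (t : LabelledRootedTree n) (k : ℕ) : Prop :=
  t.evenStar ≤ (k - 1) * (k - 2) / 2 ∧ t.oddStar ≤ (k - 1) * (k - 2) / 2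

end LabelledRootedTree

/-- Rooted unlabelled trees with `n` vertices: isomorphism classes of rooted trees. -/
abbrev UnlabelledRootedTree (n : ℕ) : Type :=
  Quotient (LabelledRootedTree.isoSetoid n)

/-- The number of rooted unlabelled trees with `n` vertices having a property `P`
(used only for properties invariant under isomorphism). -/
noncomputable def countTrees (n : ℕ) (P : LabelledRootedTree n → Prop) : ℕ :=
  {q : UnlabelledRootedTree n | ∃ t : LabelledRootedTree n, ⟦t⟧ = q ∧ P t}.ncard

/-- `N_d`, the maximal number of vertices of the tree of a curve of degree `d ≥ 1`. -/
def N (d : ℕ) : ℕ :=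
  if Odd d then (d - 1) * (d - 2) / 2 + 1 else (d - 1) * (d - 2) / 2 + 2

/-- `A_d`, the number of rooted unlabelled trees with at most `N_d` vertices satisfying the Arnold
inequalities; they are those of the parameter `k = d / 2` if `d` is even, and those coming from
the degree `d + 1`, that is `k = (d + 1) / 2`, if `d` is odd. -/
noncomputable def A (d : ℕ) : ℕ :=
  ∑ n ∈ Finset.Icc 1 (N d), countTrees n fun t => t.SatisfiesArnold ((d + 1) / 2)

/-- `a_{n,k}`, the number of rooted unlabelled trees with `n` vertices and `k` leaves. -/
noncomputable def a (n k : ℕ) : ℕ :=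
  countTrees n fun t => t.numLeaves = k

/-- `r(ζ)`: for `ζ > 0`, the radius of convergence in `x` of the generating series
`T(x, ζ) = ∑ a_{n,k} x ^ n ζ ^ k`. -/
noncomputable def r (ζ : ℝ) : ℝ :=
  sSup {x : ℝ | 0 ≤ x ∧ Summable fun p : ℕ × ℕ => (a p.1 p.2 : ℝ) * x ^ p.1 * ζ ^ p.2}

/-- `x₀`, the maximum of `r(ζ) √ζ` over `ζ > 0`. -/
noncomputable def x₀ : ℝ :=
  sSup ((fun ζ : ℝ => r ζ * √ζ) '' Set.Ioi 0)

/-- The constant `C₁ = 1 / x₀`. -/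
noncomputable def C₁ : ℝ := 1 / x₀

/-- Exponential equivalence of sequences: `log u_d ∼ log v_d` as `d → ∞`. -/
def ExpEquivalent (u v : ℕ → ℝ) : Prop :=
  (fun d => Real.log (u d)) ~[atTop] (fun d => Real.log (v d))

end PlaneTrees

/-!
The growth of `A d` is governed by the number of trees with about `d² / 2` vertices at least half of
which are leaves, the vertices with children being evenly spread over even and odd distances.

*Trees.* An unordered rooted tree of height at most `h + 1` is a multiset of such trees of height at
most `h`. This gives types `BTree h`, and isomorphism classes of rooted trees on `Fin n` correspond
to the elements of `BTree h` of size `n` as soon as `n ≤ h` (`exists_injective_class`).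

*The constant.* Pólya's functional equation `T = x ζ - x + x exp (∑ₖ T(xᵏ, ζᵏ) / k)` yields two
criteria. A supersolution bounds `T` (`genFun_le_of_supersolution`). Conversely, if `T` is finite,
lower bounds for `T(xʲ, ζʲ)`, `j ≥ 2`, propagate from large `j` to small `j`, and then
`x exp (1 + x ζ - x + ∑_{k ≥ 2} T(xᵏ, ζᵏ) / k) > 1` is contradictory, because the equation for
`j = 1` has no solution (`genFun_eq_top_of_lowerCert`). Rational certificates decide convergence at
four points close to the optimum. By Hölder's inequality the domain of convergence is convex in
logarithmic coordinates, so `log (r ζ √ζ)` is a concave function of `log ζ`, and the four points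
control it for all `ζ` (`Conv.le`). They also show that the supremum `x₀` is approached with `ζ ≥ 1`.

*Upper bound for `A d`.* For `ζ ≥ 1` each tree counted by `A d` contributes to `T(x, ζ)` at least
about `(x √ζ) ^ N d`, since it has at most `N d` vertices and the Arnold inequalities bound its
non-leaves by about `N d / 2` (`Conv.exists_A_le`).

*Lower bound for `A d`.* For every `ζ` the series diverges beyond `x₀ / √ζ`, so there are `n`, `e`,
`o` for which the number of trees with these parameters is large in the sense of `IsBlock`. Moving
`ζ` up from `1` one finds either one such family with enough leaves, or two families for nearly the
same `ζ`, one with too few leaves and one with enough, which balance each other in suitable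
proportions (`hasUnit`). Trees are combined along a chain: a root carries the next tree and the rest
of the chain. They can be recovered from the chain by their sizes, so the counts multiply, and two
consecutive trees of a family exchange even and odd distances, so both Arnold inequalities are
treated alike (`innerCount_two_steps`).
-/

/-! ### Unordered rooted trees of bounded height -/

namespace RootedTrees

/-- Unordered rooted trees of height at most `h`: a tree of height at most `h + 1` is the multiset
of the subtrees hanging at the neighbours of its root. -/
def BTree : ℕ → Type
  | 0 => Unit
  | h + 1 => Multiset (BTree h)

/-- The sum over the vertices `v` of a tree of the number `ℓ k b`, where `k` is the distance from
`v` to the root and `b` tells whether `v` has no child. -/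
def stat : (h : ℕ) → (ℕ → Bool → ℕ) → BTree h → ℕ
  | 0, ℓ, _ => ℓ 0 true
  | h + 1, ℓ, s => ℓ 0 (decide (Multiset.card (α := BTree h) s = 0)) +
      (Multiset.map (stat h fun k => ℓ (k + 1)) s).sum

/-- The number of vertices. -/
abbrev size {h : ℕ} (t : BTree h) : ℕ := stat h (fun _ _ => 1) t

/-- The local weight that counts the vertices without children. -/
def leafWeight (_ : ℕ) (b : Bool) : ℕ := if b then 1 else 0

/-- The local weight that counts the vertices with children at even distance from the root. -/
def evenWeight (k : ℕ) (b : Bool) : ℕ := if b = false ∧ Even k then 1 else 0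

/-- The local weight that counts the vertices with children at odd distance from the root. -/
def oddWeight (k : ℕ) (b : Bool) : ℕ := if b = false ∧ Odd k then 1 else 0

/-- The number of leaves. -/
abbrev leaves {h : ℕ} (t : BTree h) : ℕ := stat h leafWeight t

/-- The number of non-leaf vertices at even distance from the root, the root included. -/
abbrev evenInner {h : ℕ} (t : BTree h) : ℕ := stat h evenWeight t

/-- The number of non-leaf vertices at odd distance from the root. -/
abbrev oddInner {h : ℕ} (t : BTree h) : ℕ := stat h oddWeight t

/-- The tree whose root carries the given subtrees. -/
def node {h : ℕ} (s : Multiset (BTree h)) : BTree (h + 1) := s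

lemma exists_eq_node {h : ℕ} (t : BTree (h + 1)) : ∃ s : Multiset (BTree h), t = node s := ⟨t, rfl⟩

lemma stat_node {h : ℕ} (ℓ : ℕ → Bool → ℕ) (s : Multiset (BTree h)) :
    stat (h + 1) ℓ (node s) = ℓ 0 (decide (Multiset.card s = 0)) +
      (s.map (stat h fun k => ℓ (k + 1))).sum := rfl

lemma stat_add (h : ℕ) (ℓ ℓ' : ℕ → Bool → ℕ) (t : BTree h) :
    stat h (fun k b => ℓ k b + ℓ' k b) t = stat h ℓ t + stat h ℓ' t := by
  induction h generalizing ℓ ℓ' with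
  | zero => rfl
  | succ h ih =>
    obtain ⟨s, hs⟩ := exists_eq_node t
    simp only [hs, stat_node]
    have : (stat h fun k b => ℓ (k + 1) b + ℓ' (k + 1) b) =
        fun t => stat h (fun k => ℓ (k + 1)) t + stat h (fun k => ℓ' (k + 1)) t := by
      funext t
      exact ih _ _ t
    rw [this, Multiset.sum_map_add]
    ring

lemma size_eq (h : ℕ) (t : BTree h) : size t = leaves t + (evenInner t + oddInner t) := by
  simp only [size, leaves, evenInner, oddInner, ← stat_add]
  congr 1
  funext k b
  rcases Nat.even_or_odd k with hk | hk
  · have := Nat.not_odd_iff_even.2 hk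
    cases b <;> simp [leafWeight, evenWeight, oddWeight, hk, this]
  · have := Nat.not_even_iff_odd.2 hk
    cases b <;> simp [leafWeight, evenWeight, oddWeight, hk, this]

lemma size_pos {h : ℕ} (t : BTree h) : 0 < size t := by
  cases h with
  | zero => exact Nat.one_pos
  | succ h => exact Nat.lt_of_lt_of_le Nat.one_pos (Nat.le_add_right 1 _)

lemma evenWeight_succ : (fun k => evenWeight (k + 1)) = oddWeight := by
  funext k b
  simp [evenWeight, oddWeight, Nat.even_add_one]

lemma oddWeight_succ : (fun k => oddWeight (k + 1)) = evenWeight := by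
  funext k b
  simp [evenWeight, oddWeight, Nat.odd_add_one]

/-- Rooted trees on the vertex set `V`, given by the parent function (whose value at the root is
irrelevant) and the distance to the root. -/
structure ParentTree (V : Type) where
  /-- the root -/
  root : V
  /-- the parent of a vertex other than the root -/
  parent : V → V
  /-- the distance to the root -/
  depth : V → ℕ
  depth_root : depth root = 0
  depth_eq : ∀ v, v ≠ root → depth v = depth (parent v) + 1

namespace ParentTree

variable {V V' : Type}

lemma eq_root_of_depth (R : ParentTree V) {v : V} (hv : R.depth v = 0) : v = R.root := by
  by_contra h
  have := R.depth_eq v h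
  omega

variable [Fintype V] [Fintype V']

open Classical in
/-- The children of a vertex. -/
noncomputable def children (R : ParentTree V) (v : V) : Finset V :=
  Finset.univ.filter fun w => w ≠ R.root ∧ R.parent w = v

lemma mem_children (R : ParentTree V) {v w : V} :
    w ∈ R.children v ↔ w ≠ R.root ∧ R.parent w = v := by
  classical
  simp [children]

lemma depth_of_mem_children (R : ParentTree V) {v w : V} (hw : w ∈ R.children v) :
    R.depth w = R.depth v + 1 := by
  obtain ⟨h1, h2⟩ := R.mem_children.1 hw
  rw [R.depth_eq w h1, h2]

/-- The unordered tree formed by the descendants of `v` up to `h` generations. -/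
noncomputable def code (R : ParentTree V) : (h : ℕ) → V → BTree h
  | 0, _ => ()
  | h + 1, v => node (Multiset.map (R.code h) (R.children v).val)

/-- If `φ` carries the children of each vertex satisfying `p` to the children of its image, and `p`
passes to children, then the codes of such a vertex and of its image agree. -/
lemma code_map (R : ParentTree V) (R' : ParentTree V') (φ : V ↪ V') (p : V → Prop)
    (hp : ∀ v, p v → ∀ c ∈ R.children v, p c)
    (hφ : ∀ v, p v → R'.children (φ v) = (R.children v).map φ) (h : ℕ) (v : V) (hv : p v) :
    R'.code h (φ v) = R.code h v := by
  induction h generalizing v with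
  | zero => rfl
  | succ h ih =>
    simp only [code]
    rw [hφ v hv, Finset.map_val, Multiset.map_map]
    exact Multiset.map_congr rfl fun c hc => ih c (hp v hv c hc)

/-- The statistic of the subtrees at distance `k` from the root, by induction on the number `j` of
remaining generations. -/
lemma stat_code_aux (R : ParentTree V) (h : ℕ) (hd : ∀ v, R.depth v ≤ h) (j : ℕ) :
    ∀ (k : ℕ) (_ : k + j = h) (ℓ : ℕ → Bool → ℕ),
    ∑ v with R.depth v = k, stat j ℓ (R.code j v) =
      ∑ v with k ≤ R.depth v, ℓ (R.depth v - k) (decide ((R.children v).card = 0)) := by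
  induction j with
  | zero =>
    intro k hk ℓ
    have : (Finset.univ.filter fun v => k ≤ R.depth v) =
        Finset.univ.filter fun v => R.depth v = k := by
      ext v
      have := hd v
      simp only [Finset.mem_filter, Finset.mem_univ, true_and]
      omega
    rw [this]
    refine Finset.sum_congr rfl fun v hv => ?_
    have hv' : R.depth v = k := (Finset.mem_filter.1 hv).2
    have hc : R.children v = ∅ := by
      refine Finset.eq_empty_of_forall_notMem fun w hw => ?_
      have h1 := R.depth_of_mem_children hw
      have h2 := hd w
      omega
    simp [stat, hv', hc]
  | succ j ih =>
    intro k hk ℓ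
    have hstep : ∀ v, stat (j + 1) ℓ (R.code (j + 1) v) =
        ℓ 0 (decide ((R.children v).card = 0)) +
          ∑ c ∈ R.children v, stat j (fun k => ℓ (k + 1)) (R.code j c) := by
      intro v
      simp only [stat_node, code, Multiset.card_map, Multiset.map_map]
      rfl
    simp only [hstep, Finset.sum_add_distrib]
    have hunion : ∑ v with R.depth v = k, ∑ c ∈ R.children v,
          stat j (fun k => ℓ (k + 1)) (R.code j c) =
        ∑ c with R.depth c = k + 1, stat j (fun k => ℓ (k + 1)) (R.code j c) := by
      classical
      rw [← Finset.sum_biUnion]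
      · refine Finset.sum_congr ?_ fun _ _ => rfl
        ext c
        simp only [Finset.mem_biUnion, Finset.mem_filter, Finset.mem_univ, true_and]
        constructor
        · rintro ⟨v, hv, hc⟩
          rw [R.depth_of_mem_children hc, hv]
        · intro hc
          have hr : c ≠ R.root := by
            rintro rfl
            rw [R.depth_root] at hc
            omega
          refine ⟨R.parent c, ?_, R.mem_children.2 ⟨hr, rfl⟩⟩
          have := R.depth_eq c hr
          omega
      · intro v _ w _ hvw
        refine Finset.disjoint_left.2 fun c hc hc' => hvw ?_
        rw [← (R.mem_children.1 hc).2, ← (R.mem_children.1 hc').2]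
    rw [hunion, ih (k + 1) (by omega)]
    have hsplit : (Finset.univ.filter fun v => k ≤ R.depth v) =
        (Finset.univ.filter fun v => R.depth v = k).disjUnion
          (Finset.univ.filter fun v => k + 1 ≤ R.depth v) (by
            refine Finset.disjoint_filter.2 fun v _ h1 h2 => ?_
            omega) := by
      ext v
      simp only [Finset.mem_disjUnion, Finset.mem_filter, Finset.mem_univ, true_and]
      omega
    rw [hsplit, Finset.sum_disjUnion]
    congr 1
    · refine Finset.sum_congr rfl fun v hv => ?_
      rw [(Finset.mem_filter.1 hv).2, Nat.sub_self]
    · refine Finset.sum_congr rfl fun v hv => ?_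
      have h1 := (Finset.mem_filter.1 hv).2
      have h2 : R.depth v - k = R.depth v - (k + 1) + 1 := by omega
      rw [h2]

/-- The statistic of the code is the sum of the local weights over the vertices. -/
lemma stat_code (R : ParentTree V) (h : ℕ) (hd : ∀ v, R.depth v ≤ h) (ℓ : ℕ → Bool → ℕ) :
    stat h ℓ (R.code h R.root) = ∑ v, ℓ (R.depth v) (decide ((R.children v).card = 0)) := by
  have h0 := R.stat_code_aux h hd h 0 (Nat.zero_add h) ℓ
  have h1 : (Finset.univ.filter fun v => R.depth v = 0) = {R.root} := by
    ext v
    simp only [Finset.mem_filter, Finset.mem_univ, true_and, Finset.mem_singleton]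
    exact ⟨R.eq_root_of_depth, fun h => h ▸ R.depth_root⟩
  rw [h1, Finset.sum_singleton] at h0
  simpa using h0

lemma size_code (R : ParentTree V) (h : ℕ) (hd : ∀ v, R.depth v ≤ h) :
    size (R.code h R.root) = Fintype.card V := by
  rw [size, R.stat_code h hd]
  simp

/-! ### Realizing unordered trees on finite vertex sets -/

/-- The tree on the single vertex `()`. -/
def single : ParentTree Unit where
  root := ()
  parent := id
  depth := fun _ => 0
  depth_root := rfl
  depth_eq := fun _ hv => (hv rfl).elim

/-- The tree obtained from the disjoint union of two trees by making the root of the second one a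
child of the root of the first one. -/
noncomputable def graft (R : ParentTree V) (R' : ParentTree V') : ParentTree (V ⊕ V') where
  root := Sum.inl R.root
  parent := open Classical in Sum.elim (fun v => Sum.inl (R.parent v))
    (fun v => if v = R'.root then Sum.inl R.root else Sum.inr (R'.parent v))
  depth := Sum.elim R.depth fun v => R'.depth v + 1
  depth_root := R.depth_root
  depth_eq := by
    rintro (v | v) hv
    · exact R.depth_eq v fun h => hv (congrArg _ h)
    · by_cases h : v = R'.root
      · simp [h, R.depth_root, R'.depth_root]
      · simp [h, R'.depth_eq v h]

lemma graft_children_inr (R : ParentTree V) (R' : ParentTree V') (v : V') :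
    (R.graft R').children (Sum.inr v) = (R'.children v).map Function.Embedding.inr := by
  ext (w | w)
  · simp [mem_children, graft]
  · by_cases h : w = R'.root <;> simp [mem_children, graft, h]

lemma graft_children_inl (R : ParentTree V) (R' : ParentTree V') (v : V) (hv : v ≠ R.root) :
    (R.graft R').children (Sum.inl v) = (R.children v).map Function.Embedding.inl := by
  ext (w | w)
  · simp [mem_children, graft]
  · by_cases h : w = R'.root <;> simp [mem_children, graft, h, hv.symm]

lemma graft_children_root (R : ParentTree V) (R' : ParentTree V') :
    (R.graft R').children (R.graft R').root = Finset.cons (Sum.inr R'.root)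
      ((R.children R.root).map Function.Embedding.inl) (by simp) := by
  ext (w | w)
  · simp [mem_children, graft]
  · by_cases h : w = R'.root <;> simp [mem_children, graft, h]

lemma code_graft (R : ParentTree V) (R' : ParentTree V') (h : ℕ) :
    (R.graft R').code (h + 1) (R.graft R').root =
      node (R'.code h R'.root ::ₘ (R.children R.root).val.map (R.code h)) := by
  rw [code, graft_children_root, Finset.cons_val, Multiset.map_cons, Finset.map_val, Multiset.map_map]
  congr 2
  · exact code_map R' (R.graft R') Function.Embedding.inr (fun _ => True) (fun _ _ _ _ => trivial)
      (fun v _ => R.graft_children_inr R' v) h R'.root trivial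
  · refine Multiset.map_congr rfl fun c hc => ?_
    refine code_map R (R.graft R') Function.Embedding.inl (fun v => v ≠ R.root)
      (fun _ _ c hc => (R.mem_children.1 hc).1) (fun w hw => R.graft_children_inl R' w hw) h c ?_
    exact (R.mem_children.1 hc).1

/-- Every unordered tree of height at most `h` is the code of a tree on a finite set. -/
lemma exists_code_eq (h : ℕ) (t : BTree h) : ∃ (V : Type) (_ : Fintype V) (R : ParentTree V),
    (∀ v, R.depth v ≤ h) ∧ R.code h R.root = t := by
  induction h with
  | zero => exact ⟨Unit, inferInstance, single, fun _ => le_rfl, rfl⟩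
  | succ h ih =>
    obtain ⟨s, hs⟩ := exists_eq_node t
    rw [hs]
    clear hs
    induction s using Multiset.induction_on with
    | empty =>
      refine ⟨Unit, inferInstance, single, fun _ => Nat.zero_le _, ?_⟩
      have : single.children single.root = ∅ :=
        Finset.eq_empty_of_forall_notMem fun w hw => (single.mem_children.1 hw).1 rfl
      simp only [code, this]
      rfl
    | cons t' s hs =>
      obtain ⟨V, _, R, hR, hRs⟩ := hs
      obtain ⟨V', _, R', hR', hRs'⟩ := ih t'
      refine ⟨V ⊕ V', inferInstance, R.graft R', ?_, ?_⟩
      · rintro (v | v)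
        · exact hR v
        · exact Nat.succ_le_succ (hR' v)
      · rw [code_graft, hRs']
        exact congrArg (fun s => node (t' ::ₘ s)) hRs

/-- Transport of a tree along a bijection of the vertex sets. -/
def transport (R : ParentTree V) (e : V ≃ V') : ParentTree V' where
  root := e R.root
  parent := fun v => e (R.parent (e.symm v))
  depth := fun v => R.depth (e.symm v)
  depth_root := by simp [R.depth_root]
  depth_eq := fun v hv => by
    simpa using R.depth_eq (e.symm v) fun h => hv (by simp [← h])

lemma code_transport (R : ParentTree V) (e : V ≃ V') (h : ℕ) :
    (R.transport e).code h (R.transport e).root = R.code h R.root := by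
  refine code_map R (R.transport e) e.toEmbedding (fun _ => True) (fun _ _ _ _ => trivial)
    (fun v _ => ?_) h R.root trivial
  ext w
  obtain ⟨w, rfl⟩ := e.surjective w
  simp [mem_children, transport]

lemma exists_fin_code_eq (h : ℕ) (t : BTree h) : ∃ R : ParentTree (Fin (size t)),
    (∀ v, R.depth v ≤ h) ∧ R.code h R.root = t := by
  obtain ⟨V, _, R, hR, rfl⟩ := exists_code_eq h t
  rw [R.size_code h hR]
  exact ⟨R.transport (Fintype.equivFin V), fun v => hR _, R.code_transport _ h⟩

end ParentTree

/-! ### Labelled rooted trees and parent functions -/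

namespace ParentTree

variable {V V' : Type}

lemma parent_ne (R : ParentTree V) {v : V} (hv : v ≠ R.root) : R.parent v ≠ v := fun h => by
  have := R.depth_eq v hv
  rw [h] at this
  omega

/-- The graph whose edges join the vertices to their parents. -/
def graph (R : ParentTree V) : SimpleGraph V where
  Adj v w := (w ≠ R.root ∧ R.parent w = v) ∨ (v ≠ R.root ∧ R.parent v = w)
  symm := ⟨fun _ _ h => h.symm⟩
  loopless := ⟨fun _ h => h.elim (fun h => R.parent_ne h.1 h.2) (fun h => R.parent_ne h.1 h.2)⟩

lemma graph_adj (R : ParentTree V) {v w : V} : R.graph.Adj v w ↔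
    (w ≠ R.root ∧ R.parent w = v) ∨ (v ≠ R.root ∧ R.parent v = w) := Iff.rfl

lemma exists_walk (R : ParentTree V) (k : ℕ) :
    ∀ v, R.depth v = k → ∃ p : R.graph.Walk R.root v, p.length = k := by
  induction k with
  | zero =>
    intro v hv
    obtain rfl := R.eq_root_of_depth hv
    exact ⟨.nil, rfl⟩
  | succ k ih =>
    intro v hv
    have hr : v ≠ R.root := by
      rintro rfl
      rw [R.depth_root] at hv
      omega
    obtain ⟨p, hp⟩ := ih (R.parent v) (by have := R.depth_eq v hr; omega)
    exact ⟨p.concat (R.graph_adj.2 (Or.inl ⟨hr, rfl⟩)), by rw [SimpleGraph.Walk.length_concat, hp]⟩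

lemma connected (R : ParentTree V) : R.graph.Connected := by
  have : Nonempty V := ⟨R.root⟩
  refine SimpleGraph.Connected.mk fun v w => ?_
  obtain ⟨p, -⟩ := R.exists_walk _ v rfl
  obtain ⟨q, -⟩ := R.exists_walk _ w rfl
  exact p.reachable.symm.trans q.reachable

lemma depth_le_of_walk (R : ParentTree V) {v w : V} (p : R.graph.Walk v w) :
    R.depth w ≤ R.depth v + p.length := by
  induction p with
  | nil => simp
  | cons h p ih =>
    rw [SimpleGraph.Walk.length_cons]
    rcases R.graph_adj.1 h with ⟨h1, h2⟩ | ⟨h1, h2⟩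
    · have := R.depth_eq _ h1
      rw [h2] at this
      omega
    · have := R.depth_eq _ h1
      rw [h2] at this
      omega

lemma dist_eq (R : ParentTree V) (v : V) : R.graph.dist R.root v = R.depth v := by
  apply le_antisymm
  · obtain ⟨p, hp⟩ := R.exists_walk _ v rfl
    exact hp ▸ SimpleGraph.dist_le p
  · obtain ⟨p, hp⟩ := R.connected.exists_walk_length_eq_dist R.root v
    have := R.depth_le_of_walk p
    rw [R.depth_root, hp] at this
    omega

lemma isTree [Finite V] (R : ParentTree V) : R.graph.IsTree := by
  classical
  have := Fintype.ofFinite V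
  rw [SimpleGraph.isTree_iff_connected_and_card]
  refine ⟨R.connected, le_antisymm ?_ R.connected.card_vert_le_card_edgeSet_add_one⟩
  -- the non-root vertices map onto the edges
  have hsurj : Function.Surjective (fun v : {v : V // v ≠ R.root} =>
      (⟨s(v.1, R.parent v.1), (R.graph_adj.2 (Or.inr ⟨v.2, rfl⟩))⟩ : R.graph.edgeSet)) := by
    rintro ⟨e, he⟩
    induction e with
    | _ v w =>
      rcases R.graph_adj.1 he with ⟨h1, h2⟩ | ⟨h1, h2⟩
      · exact ⟨⟨w, h1⟩, Subtype.ext (by simp [h2, Sym2.eq_swap])⟩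
      · exact ⟨⟨v, h1⟩, Subtype.ext (by simp [h2])⟩
  have h1 := Nat.card_le_card_of_surjective _ hsurj
  change Nat.card R.graph.edgeSet ≤ _ at h1
  change Nat.card R.graph.edgeSet + 1 ≤ _
  have h2 : Nat.card {v : V // v ≠ R.root} + 1 = Nat.card V := by
    have h3 : 0 < Fintype.card V := Fintype.card_pos_iff.2 ⟨R.root⟩
    simp only [Nat.card_eq_fintype_card, Fintype.card_subtype_compl, Fintype.card_subtype_eq]
    omega
  omega

/-- The labelled rooted tree with the given parent function. -/
def toLabelled {n : ℕ} (R : ParentTree (Fin n)) : PlaneTrees.LabelledRootedTree n :=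
  ⟨R.graph, R.root, R.isTree⟩

/-- Every labelled rooted tree comes from a parent function. -/
lemma exists_toLabelled_eq {n : ℕ} (t : PlaneTrees.LabelledRootedTree n) :
    ∃ R : ParentTree (Fin n), R.toLabelled = t := by
  have hex : ∀ v, v ≠ t.root → ∃ w, t.graph.Adj v w ∧
      t.graph.dist t.root v = t.graph.dist t.root w + 1 := by
    intro v hv
    obtain ⟨p, hp⟩ := t.isTree.connected.exists_walk_length_eq_dist v t.root
    cases p with
    | nil => exact (hv rfl).elim
    | @cons _ w _ h q =>
      refine ⟨w, h, ?_⟩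
      have h1 := SimpleGraph.dist_le q
      rw [SimpleGraph.Walk.length_cons] at hp
      rw [SimpleGraph.dist_comm, SimpleGraph.dist_comm (u := t.root)]
      have h2 := SimpleGraph.Connected.dist_triangle t.isTree.connected (u := v) (v := w)
        (w := t.root)
      rw [SimpleGraph.dist_eq_one_iff_adj.2 h] at h2
      omega
  choose! f hf using hex
  let R : ParentTree (Fin n) := ⟨t.root, f, fun v => t.graph.dist t.root v,
    SimpleGraph.dist_self, fun v hv => (hf v hv).2⟩
  have hle : R.graph ≤ t.graph := by
    intro v w h
    rcases R.graph_adj.1 h with ⟨h1, h2⟩ | ⟨h1, h2⟩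
    · rw [← h2]
      exact (hf w h1).1.symm
    · rw [← h2]
      exact (hf v h1).1
  have heq : R.graph = t.graph :=
    le_antisymm hle ((SimpleGraph.isTree_iff_minimal_connected.1 t.isTree).2 R.connected hle)
  refine ⟨R, ?_⟩
  cases t
  simp only [toLabelled]
  congr

lemma depth_lt_card [Fintype V] (R : ParentTree V) (v : V) : R.depth v < Fintype.card V := by
  obtain ⟨p, hp, hl⟩ := R.connected.exists_path_of_dist R.root v
  have := hp.length_lt
  rwa [hl, R.dist_eq] at this

/-! ### Isomorphism classes are classified by their codes -/

variable [Fintype V] [Fintype V']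

lemma code_eq_of_iso (R : ParentTree V) (R' : ParentTree V') (e : R.graph ≃g R'.graph)
    (he : e R.root = R'.root) (h : ℕ) : R'.code h R'.root = R.code h R.root := by
  have hdepth : ∀ v, R'.depth (e v) = R.depth v := by
    intro v
    rw [← R'.dist_eq, ← R.dist_eq, ← he]
    apply le_antisymm
    · obtain ⟨p, hp⟩ := R.connected.exists_walk_length_eq_dist R.root v
      rw [← hp, ← SimpleGraph.Walk.length_map e.toHom p]
      exact SimpleGraph.dist_le _
    · obtain ⟨p, hp⟩ := R'.connected.exists_walk_length_eq_dist (e R.root) (e v)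
      rw [← hp]
      have h1 := SimpleGraph.dist_le ((p.map e.symm.toHom).copy (e.symm_apply_apply R.root)
        (e.symm_apply_apply v))
      rwa [SimpleGraph.Walk.length_copy, SimpleGraph.Walk.length_map] at h1
  have hroot : ∀ v, e v ≠ R'.root ↔ v ≠ R.root := fun v => by rw [← he, e.injective.ne_iff]
  rw [← he]
  refine code_map R R' e.toEquiv.toEmbedding (fun _ => True) (fun _ _ _ _ => trivial)
    (fun v _ => ?_) h R.root trivial
  have key : ∀ v w, w ∈ R.children v ↔ R.graph.Adj v w ∧ R.depth w = R.depth v + 1 := by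
    intro v w
    refine ⟨fun hw => ⟨Or.inl (R.mem_children.1 hw), R.depth_of_mem_children hw⟩, ?_⟩
    rintro ⟨h1 | h1, h2⟩
    · exact R.mem_children.2 h1
    · have := R.depth_eq v h1.1
      rw [h1.2] at this
      omega
  have key' : ∀ v w, w ∈ R'.children v ↔ R'.graph.Adj v w ∧ R'.depth w = R'.depth v + 1 := by
    intro v w
    refine ⟨fun hw => ⟨Or.inl (R'.mem_children.1 hw), R'.depth_of_mem_children hw⟩, ?_⟩
    rintro ⟨h1 | h1, h2⟩
    · exact R'.mem_children.2 h1
    · have := R'.depth_eq v h1.1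
      rw [h1.2] at this
      omega
  ext w
  obtain ⟨w, rfl⟩ := e.surjective w
  have h3 : e w ∈ R'.children (e v) ↔ w ∈ R.children v := by
    rw [key, key', hdepth, hdepth, e.map_adj_iff]
  rw [Finset.mem_map]
  constructor
  · exact fun h => ⟨w, h3.1 h, rfl⟩
  · rintro ⟨u, hu, huw⟩
    obtain rfl : u = w := e.injective huw
    exact h3.2 hu

/-- If two vertices have equal codes, some map carries the children of the one bijectively to the
children of the other and preserves their codes. -/
lemma exists_children_map (R : ParentTree V) (R' : ParentTree V') (h : ℕ) (v : V) (v' : V')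
    (hc : R.code (h + 1) v = R'.code (h + 1) v') : ∃ f : V → V',
      (∀ c ∈ R.children v, f c ∈ R'.children v' ∧ R'.code h (f c) = R.code h c) ∧
      Set.InjOn f (R.children v) := by
  classical
  have hc' : Multiset.map (R.code h) (R.children v).val =
    Multiset.map (R'.code h) (R'.children v').val := hc
  have hcard : ∀ b, ((R.children v).filter fun c => R.code h c = b).card =
      ((R'.children v').filter fun c => R'.code h c = b).card := by
    intro b
    have := congrArg (Multiset.count b) hc'
    rw [Multiset.count_map, Multiset.count_map] at this
    simpa [Finset.card, Finset.filter_val, eq_comm] using this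
  have hbij : ∀ b, ∃ f : V → V', Set.BijOn f ((R.children v).filter fun c => R.code h c = b)
      ((R'.children v').filter fun c => R'.code h c = b) := by
    intro b
    have : Nonempty V' := ⟨R'.root⟩
    exact (Finset.finite_toSet _).exists_bijOn_of_encard_eq (by
      rw [Set.encard_coe_eq_coe_finsetCard, Set.encard_coe_eq_coe_finsetCard, hcard])
  choose f hf using hbij
  refine ⟨fun c => f (R.code h c) c, fun c hc => ?_, fun c hc d hd hcd => ?_⟩
  · have := (hf (R.code h c)).mapsTo (x := c) (by simpa using hc)
    simpa using this
  · have h1 := (hf (R.code h c)).mapsTo (x := c) (by simpa using hc)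
    have h2 := (hf (R.code h d)).mapsTo (x := d) (by simpa using hd)
    have h3 : R.code h c = R.code h d := by
      rw [Finset.mem_coe, Finset.mem_filter] at h1 h2
      rw [← h1.2, ← h2.2]
      exact congrArg _ hcd
    refine (hf (R.code h c)).injOn (by simpa using hc) ?_ ?_
    · simpa [h3] using hd
    · simp only [h3] at hcd ⊢
      exact hcd

/-- Trees on vertex sets of the same size are isomorphic if their codes agree: an isomorphism is
built along the generations. -/
lemma exists_iso_of_code_eq (R : ParentTree V) (R' : ParentTree V')
    (hcard : Fintype.card V = Fintype.card V') (h : ℕ) (hh : Fintype.card V ≤ h)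
    (hc : R.code h R.root = R'.code h R'.root) :
    ∃ e : R.graph ≃g R'.graph, e R.root = R'.root := by
  classical
  have hσ : ∀ (j : ℕ) (v : V) (v' : V'), ∃ f : V → V', R.code (j + 1) v = R'.code (j + 1) v' →
      (∀ c ∈ R.children v, f c ∈ R'.children v' ∧ R'.code j (f c) = R.code j c) ∧
      Set.InjOn f (R.children v) := by
    intro j v v'
    by_cases hc : R.code (j + 1) v = R'.code (j + 1) v'
    · obtain ⟨f, hf⟩ := R.exists_children_map R' j v v' hc
      exact ⟨f, fun _ => hf⟩
    · exact ⟨fun _ => R'.root, fun h => (hc h).elim⟩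
  choose σ hσ using hσ
  -- `F k` is the intended map on the vertices at distance `k` from the root
  let F : ℕ → V → V' := fun k => Nat.rec (fun _ => R'.root)
    (fun k Fk v => σ (h - (k + 1)) (R.parent v) (Fk (R.parent v)) v) k
  have hF : ∀ k v, F (k + 1) v = σ (h - (k + 1)) (R.parent v) (F k (R.parent v)) v :=
    fun _ _ => rfl
  have hcode : ∀ k v, R.depth v = k →
      R'.depth (F k v) = k ∧ R.code (h - k) v = R'.code (h - k) (F k v) := by
    intro k
    induction k with
    | zero =>
      intro v hv
      obtain rfl := R.eq_root_of_depth hv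
      exact ⟨R'.depth_root, hc⟩
    | succ k ih =>
      intro v hv
      have hr : v ≠ R.root := by
        rintro rfl
        rw [R.depth_root] at hv
        omega
      have hk : R.depth (R.parent v) = k := by
        have := R.depth_eq v hr
        omega
      have hlt := R.depth_lt_card v
      obtain ⟨h1, h2⟩ := ih _ hk
      have h3 : h - k = h - (k + 1) + 1 := by omega
      rw [h3] at h2
      have h4 := (hσ _ _ _ h2).1 v (R.mem_children.2 ⟨hr, rfl⟩)
      refine ⟨?_, h4.2.symm⟩
      rw [hF, R'.depth_of_mem_children h4.1, h1]
  have hstep : ∀ k v, R.depth v = k + 1 → v ∈ R.children (R.parent v) ∧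
      F (k + 1) v ∈ R'.children (F k (R.parent v)) ∧
      Set.InjOn (σ (h - (k + 1)) (R.parent v) (F k (R.parent v))) (R.children (R.parent v)) := by
    intro k v hv
    have hr : v ≠ R.root := by
      rintro rfl
      rw [R.depth_root] at hv
      omega
    have hk : R.depth (R.parent v) = k := by
      have := R.depth_eq v hr
      omega
    have hlt := R.depth_lt_card v
    obtain ⟨h1, h2⟩ := hcode _ _ hk
    have h3 : h - k = h - (k + 1) + 1 := by omega
    rw [h3] at h2
    have hmem := R.mem_children.2 ⟨hr, rfl⟩
    exact ⟨hmem, ((hσ _ _ _ h2).1 v hmem).1, (hσ _ _ _ h2).2⟩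
  have hinj : ∀ k v w, R.depth v = k → R.depth w = k → F k v = F k w → v = w := by
    intro k
    induction k with
    | zero =>
      intro v w hv hw _
      rw [R.eq_root_of_depth hv, R.eq_root_of_depth hw]
    | succ k ih =>
      intro v w hv hw hvw
      obtain ⟨hv1, hv2, hv3⟩ := hstep k v hv
      obtain ⟨hw1, hw2, hw3⟩ := hstep k w hw
      have h1 : F k (R.parent v) = F k (R.parent w) := by
        rw [← (R'.mem_children.1 hv2).2, ← (R'.mem_children.1 hw2).2, hvw]
      have h2 : R.parent v = R.parent w := by
        have h3 := R.depth_of_mem_children hv1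
        have h4 := R.depth_of_mem_children hw1
        exact ih _ _ (by omega) (by omega) h1
      refine hv3 hv1 ?_ ?_
      · rw [h2]
        exact hw1
      · rw [hF, hF, ← h2] at hvw
        exact hvw
  let G : V → V' := fun v => F (R.depth v) v
  have hGinj : Function.Injective G := by
    intro v w hvw
    have h1 := (hcode _ v rfl).1
    have h2 := (hcode _ w rfl).1
    have h3 : R.depth v = R.depth w := by
      rw [← h1, ← h2]
      exact congrArg _ hvw
    refine hinj (R.depth v) v w rfl h3.symm ?_
    have : F (R.depth v) v = F (R.depth w) w := hvw
    rw [this, h3]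
  have hGbij : Function.Bijective G := (Fintype.bijective_iff_injective_and_card G).2 ⟨hGinj, hcard⟩
  have hGroot : G R.root = R'.root := by
    change F (R.depth R.root) R.root = _
    rw [R.depth_root]
    rfl
  have hGparent : ∀ v, v ≠ R.root → R'.parent (G v) = G (R.parent v) := by
    intro v hv
    have h1 := R.depth_eq v hv
    have h2 := (R'.mem_children.1 (hstep _ v h1).2.1).2
    change R'.parent (F (R.depth v) v) = F (R.depth (R.parent v)) (R.parent v)
    rw [h1, h2]
  have hGne : ∀ v, G v ≠ R'.root ↔ v ≠ R.root := fun v => by rw [← hGroot, hGinj.ne_iff]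
  have hGadj : ∀ v w, (w ≠ R.root ∧ R.parent w = v) ↔
      (G w ≠ R'.root ∧ R'.parent (G w) = G v) := by
    intro v w
    rw [hGne]
    refine and_congr_right fun hw => ?_
    rw [hGparent w hw, hGinj.eq_iff]
  refine ⟨⟨Equiv.ofBijective G hGbij, ?_⟩, hGroot⟩
  intro v w
  change R'.graph.Adj (G v) (G w) ↔ R.graph.Adj v w
  rw [graph_adj, graph_adj, ← hGadj, ← hGadj]

end ParentTree

open PlaneTrees

/-! ### Counting isomorphism classes through codes -/

namespace ParentTree

lemma isLeaf_iff {n : ℕ} (R : ParentTree (Fin n)) (v : Fin n) :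
    R.toLabelled.IsLeaf v ↔ (R.children v).card = 0 := by
  classical
  rw [Finset.card_eq_zero]
  unfold LabelledRootedTree.IsLeaf
  change (v ≠ R.root ∧ (R.graph.neighborSet v).ncard = 1) ∨ (v = R.root ∧ ∀ w, w = R.root) ↔ _
  by_cases hv : v = R.root
  · simp only [hv, ne_eq, not_true_eq_false, false_and, true_and, false_or]
    constructor
    · intro h
      exact Finset.eq_empty_of_forall_notMem fun w hw => (R.mem_children.1 hw).1 (h w)
    · intro h
      -- otherwise the root has a child: follow the parents of a vertex different from the root
      have key : ∀ k w, R.depth w ≠ k + 1 := by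
        intro k
        induction k with
        | zero =>
          intro w hw
          have hr : w ≠ R.root := by
            rintro rfl
            rw [R.depth_root] at hw
            omega
          have h1 := R.depth_eq w hr
          have h2 : R.parent w = R.root := R.eq_root_of_depth (by omega)
          have h3 : w ∈ R.children R.root := R.mem_children.2 ⟨hr, h2⟩
          simp [h] at h3
        | succ k ih =>
          intro w hw
          have hr : w ≠ R.root := by
            rintro rfl
            rw [R.depth_root] at hw
            omega
          have h1 := R.depth_eq w hr
          exact ih (R.parent w) (by omega)
      intro w
      by_contra hr
      have h1 := R.depth_eq w hr
      exact key _ w h1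
  · have hset : R.graph.neighborSet v = ↑((R.children v).cons (R.parent v) (by
        intro h
        have h1 := R.depth_of_mem_children h
        have h2 := R.depth_eq v hv
        omega)) := by
      ext w
      simp only [SimpleGraph.mem_neighborSet, graph_adj, Finset.coe_cons, Set.mem_insert_iff,
        Finset.mem_coe, mem_children, ne_eq, hv, not_false_eq_true, true_and]
      tauto
    rw [hset, Set.ncard_coe_finset, Finset.card_cons]
    simp [hv, Finset.card_eq_zero]

variable {n : ℕ} (R : ParentTree (Fin n)) {h : ℕ} (hd : ∀ v, R.depth v ≤ h)

include hd

lemma numLeaves_eq : R.toLabelled.numLeaves = leaves (R.code h R.root) := by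
  classical
  rw [leaves, R.stat_code h hd, LabelledRootedTree.numLeaves]
  simp only [leafWeight, decide_eq_true_eq, isLeaf_iff]
  rw [← Finset.card_filter, ← Set.ncard_coe_finset]
  simp

lemma evenStar_eq : R.toLabelled.evenStar = oddInner (R.code h R.root) := by
  classical
  rw [oddInner, R.stat_code h hd, LabelledRootedTree.evenStar]
  simp only [oddWeight, decide_eq_false_iff_not, isLeaf_iff]
  rw [← Finset.card_filter, ← Set.ncard_coe_finset]
  congr 1
  ext v
  simp [toLabelled, R.dist_eq]

lemma oddStar_eq : R.toLabelled.oddStar = evenInner (R.code h R.root) - 1 := by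
  classical
  rw [evenInner, R.stat_code h hd, LabelledRootedTree.oddStar]
  simp only [evenWeight, decide_eq_false_iff_not, isLeaf_iff]
  rw [← Finset.card_filter]
  set s := Finset.univ.filter fun v => ¬(R.children v).card = 0 ∧ Even (R.depth v) with hs
  have h1 : {v | ¬(R.children v).card = 0 ∧ Even (R.toLabelled.graph.dist R.toLabelled.root v) ∧
      R.toLabelled.graph.dist R.toLabelled.root v ≠ 0} = ↑(s.erase R.root) := by
    ext v
    change ¬(R.children v).card = 0 ∧ Even (R.graph.dist R.root v) ∧ R.graph.dist R.root v ≠ 0 ↔ _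
    rw [R.dist_eq]
    have : R.depth v ≠ 0 ↔ v ≠ R.root :=
      not_congr ⟨R.eq_root_of_depth, fun h => h ▸ R.depth_root⟩
    simp only [Finset.coe_erase, Set.mem_sdiff, Finset.mem_coe, Set.mem_singleton_iff, hs,
      Finset.mem_filter, Finset.mem_univ, true_and, this]
    tauto
  rw [h1, Set.ncard_coe_finset]
  by_cases hr : R.root ∈ s
  · exact Finset.card_erase_of_mem hr
  · have h2 : R.toLabelled.IsLeaf R.root := by
      rw [isLeaf_iff]
      by_contra h3
      exact hr (by simpa [hs, R.depth_root] using h3)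
    have h3 : ∀ w, w = R.root := h2.elim (fun h => (h.1 rfl).elim) fun h => h.2
    have h4 : s = ∅ := Finset.eq_empty_of_forall_notMem fun w hw => hr (h3 w ▸ hw)
    simp [h4]

end ParentTree

instance (n : ℕ) : Finite (LabelledRootedTree n) :=
  Finite.of_injective (fun t : LabelledRootedTree n => (t.graph, t.root)) fun s t h => by
    cases s
    cases t
    simp only [Prod.mk.injEq] at h
    obtain ⟨rfl, rfl⟩ := h
    rfl

section Count

variable {n h : ℕ} {P : LabelledRootedTree n → Prop} {Q : BTree h → Prop}

/-- The trees of height at most `h` satisfying `Q` inject into the isomorphism classes satisfying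
`P` if `P` amounts to `Q` on codes; all classes are reached when `n ≤ h`. -/
lemma exists_injective_class
    (hPQ : ∀ R : ParentTree (Fin n), (∀ v, R.depth v ≤ h) →
      (P R.toLabelled ↔ Q (R.code h R.root))) :
    ∃ g : {t : BTree h // size t = n ∧ Q t} →
        {q : UnlabelledRootedTree n // ∃ t, ⟦t⟧ = q ∧ P t},
      Function.Injective g ∧ (n ≤ h → Function.Surjective g) := by
  have key : ∀ t : {t : BTree h // size t = n ∧ Q t}, ∃ R : ParentTree (Fin n),
      (∀ v, R.depth v ≤ h) ∧ R.code h R.root = t.1 := by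
    rintro ⟨t, rfl, _⟩
    exact ParentTree.exists_fin_code_eq h t
  choose R hR hRt using key
  refine ⟨fun t => ⟨⟦(R t).toLabelled⟧, _, rfl, ?_⟩, ?_, ?_⟩
  · rw [hPQ _ (hR t), hRt]
    exact t.2.2
  · intro t t' htt
    obtain ⟨e, he⟩ := Quotient.exact (congrArg Subtype.val htt)
    have := (R t).code_eq_of_iso (R t') e he h
    rw [hRt, hRt] at this
    exact Subtype.ext this.symm
  · rintro hn ⟨q, t, rfl, ht⟩
    obtain ⟨S, rfl⟩ := ParentTree.exists_toLabelled_eq t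
    have hS : ∀ v, S.depth v ≤ h := fun v => by
      have := S.depth_lt_card v
      rw [Fintype.card_fin] at this
      omega
    let u : {t : BTree h // size t = n ∧ Q t} := ⟨S.code h S.root,
      by rw [S.size_code h hS, Fintype.card_fin], (hPQ S hS).1 ht⟩
    refine ⟨u, Subtype.ext (Quotient.sound ?_)⟩
    exact (R u).exists_iso_of_code_eq S rfl h (by simpa using hn) (hRt u)

lemma card_le_countTrees
    (hPQ : ∀ R : ParentTree (Fin n), (∀ v, R.depth v ≤ h) →
      (P R.toLabelled ↔ Q (R.code h R.root))) :
    Nat.card {t : BTree h // size t = n ∧ Q t} ≤ countTrees n P := by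
  obtain ⟨g, hg, -⟩ := exists_injective_class hPQ
  exact Nat.card_le_card_of_injective g hg

lemma card_eq_countTrees (hn : n ≤ h)
    (hPQ : ∀ R : ParentTree (Fin n), (∀ v, R.depth v ≤ h) →
      (P R.toLabelled ↔ Q (R.code h R.root))) :
    Nat.card {t : BTree h // size t = n ∧ Q t} = countTrees n P := by
  obtain ⟨g, hg, hs⟩ := exists_injective_class hPQ
  exact Nat.card_congr (Equiv.ofBijective g ⟨hg, hs hn⟩)

instance (h n : ℕ) (Q : BTree h → Prop) : Finite {t : BTree h // size t = n ∧ Q t} := by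
  have h1 : Finite {t : BTree h // size t = n ∧ True} := by
    obtain ⟨g, hg, -⟩ := exists_injective_class (h := h) (n := n) (P := fun _ => True)
      (Q := fun _ => True) fun _ _ => Iff.rfl
    exact Finite.of_injective g hg
  exact Finite.of_injective
    (fun t : {t : BTree h // size t = n ∧ Q t} =>
      (⟨t.1, t.2.1, trivial⟩ : {t : BTree h // size t = n ∧ True}))
    fun s t hst => Subtype.ext (congrArg (fun u => u.1) hst)

end Count

/-- Unordered trees of height at most `h` with `n` vertices and `m` leaves are counted by `a n m`
as soon as `n ≤ h`. -/
lemma card_eq_a {n h : ℕ} (hn : n ≤ h) (m : ℕ) :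
    Nat.card {t : BTree h // size t = n ∧ leaves t = m} = a n m :=
  card_eq_countTrees hn fun R hR => by rw [R.numLeaves_eq hR]

lemma card_le_a (n h m : ℕ) :
    Nat.card {t : BTree h // size t = n ∧ leaves t = m} ≤ a n m :=
  card_le_countTrees fun R hR => by rw [R.numLeaves_eq hR]

open ENNReal Topology

/-! ### Sums over multisets -/

section Multisets

variable {α : Type} [DecidableEq α]

/-- Multisets supported in `insert b A` split into the multiplicity of `b` and the rest. -/
def multisetInsertEquiv (A : Finset α) (b : α) (hb : b ∉ A) :
    ℕ × {s : Multiset α // ∀ c ∈ s, c ∈ A} ≃ {s : Multiset α // ∀ c ∈ s, c ∈ insert b A} where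
  toFun p := ⟨Multiset.replicate p.1 b + p.2.1, fun c hc => by
    rcases Multiset.mem_add.1 hc with h | h
    · simp [Multiset.eq_of_mem_replicate h]
    · exact Finset.mem_insert_of_mem (p.2.2 c h)⟩
  invFun s := ⟨s.1.count b, s.1.filter fun c => c ≠ b, fun c hc => by
    obtain ⟨h1, h2⟩ := Multiset.mem_filter.1 hc
    exact Finset.mem_of_mem_insert_of_ne (s.2 c h1) h2⟩
  left_inv := by
    rintro ⟨k, s, hs⟩
    have h1 : b ∉ s := fun h => hb (hs b h)
    have h2 : s.filter (fun c => c ≠ b) = s :=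
      Multiset.filter_eq_self.2 fun c hc h => h1 (h ▸ hc)
    have h3 : (Multiset.replicate k b).filter (fun c => c ≠ b) = 0 :=
      Multiset.filter_eq_nil.2 fun c hc => by simp [Multiset.eq_of_mem_replicate hc]
    simp [h1, h2, h3, Multiset.filter_add]
  right_inv := by
    rintro ⟨s, hs⟩
    refine Subtype.ext ?_
    change Multiset.replicate (s.count b) b + s.filter (fun c => c ≠ b) = s
    rw [← Multiset.filter_eq']
    exact Multiset.filter_add_not _ _

/-- The generating function of the multisets supported in a finite set is a product of geometric
series. -/
lemma tsum_multiset_finset (w : α → ℝ≥0∞) (A : Finset α) :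
    ∑' s : {s : Multiset α // ∀ c ∈ s, c ∈ A}, (s.1.map w).prod = ∏ c ∈ A, (1 - w c)⁻¹ := by
  induction A using Finset.induction_on with
  | empty =>
    rw [Finset.prod_empty, tsum_eq_single ⟨0, by simp⟩]
    · simp
    · rintro ⟨s, hs⟩ hne
      refine (hne (Subtype.ext (Multiset.eq_zero_of_forall_notMem fun c hc => ?_))).elim
      simpa using hs c hc
  | insert b A hb ih =>
    rw [← (multisetInsertEquiv A b hb).tsum_eq, ENNReal.tsum_prod', Finset.prod_insert hb]
    simp only [multisetInsertEquiv, Equiv.coe_fn_mk, Multiset.map_add, Multiset.prod_add,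
      Multiset.map_replicate, Multiset.prod_replicate]
    simp only [ENNReal.tsum_mul_left, ENNReal.tsum_mul_right, ih, ENNReal.tsum_geometric]

lemma prod_le_tsum_multiset (w : α → ℝ≥0∞) (A : Finset α) :
    ∏ c ∈ A, (1 - w c)⁻¹ ≤ ∑' s : Multiset α, (s.map w).prod := by
  rw [← tsum_multiset_finset]
  exact ENNReal.tsum_comp_le_tsum_of_injective Subtype.val_injective fun s : Multiset α =>
    (s.map w).prod

lemma tsum_multiset_le (w : α → ℝ≥0∞) (B : ℝ≥0∞)
    (h : ∀ A : Finset α, ∏ c ∈ A, (1 - w c)⁻¹ ≤ B) :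
    ∑' s : Multiset α, (s.map w).prod ≤ B := by
  rw [ENNReal.tsum_eq_iSup_sum]
  refine iSup_le fun S => ?_
  let A := S.biUnion Multiset.toFinset
  refine le_trans ?_ (h A)
  rw [← tsum_multiset_finset]
  have hS : ∀ s ∈ S, ∀ c ∈ s, c ∈ A := fun s hs c hc =>
    Finset.mem_biUnion.2 ⟨s, hs, Multiset.mem_toFinset.2 hc⟩
  let f : {s // s ∈ S} → {s : Multiset α // ∀ c ∈ s, c ∈ A} := fun s => ⟨s.1, hS s.1 s.2⟩
  have hf : Function.Injective f := fun s t hst => Subtype.ext (congrArg (fun u => u.1) hst)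
  rw [← Finset.sum_attach, ← Finset.univ_eq_attach, ← tsum_fintype (L := .unconditional _)]
  exact ENNReal.tsum_comp_le_tsum_of_injective hf fun s => (s.1.map w).prod

lemma toReal_lt_one {y : ℝ≥0∞} (hy : y < 1) : y.toReal < 1 := by
  have := (ENNReal.toReal_lt_toReal hy.ne_top ENNReal.one_ne_top).2 hy
  simpa using this

omit [DecidableEq α] in
lemma prod_geometric_eq (w : α → ℝ≥0∞) (hw : ∀ c, w c < 1) (A : Finset α) :
    ∏ c ∈ A, (1 - w c)⁻¹ = ENNReal.ofReal (Real.exp (∑ c ∈ A, -Real.log (1 - (w c).toReal))) := by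
  rw [Real.exp_sum, ENNReal.ofReal_prod_of_nonneg fun _ _ => (Real.exp_pos _).le]
  refine Finset.prod_congr rfl fun c _ => ?_
  have h1 : (w c).toReal < 1 := toReal_lt_one (hw c)
  have h2 : (0 : ℝ) < 1 - (w c).toReal := by linarith
  rw [Real.exp_neg, Real.exp_log h2, ENNReal.ofReal_inv_of_pos h2,
    ENNReal.ofReal_sub _ ENNReal.toReal_nonneg, ENNReal.ofReal_one,
    ENNReal.ofReal_toReal (hw c).ne_top]

omit [DecidableEq α] in
lemma hasSum_log_sum (w : α → ℝ≥0∞) (hw : ∀ c, w c < 1) (A : Finset α) :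
    HasSum (fun k : ℕ => (∑ c ∈ A, (w c).toReal ^ (k + 1)) / (k + 1))
      (∑ c ∈ A, -Real.log (1 - (w c).toReal)) := by
  simp only [Finset.sum_div]
  refine hasSum_sum fun c _ => Real.hasSum_pow_div_log_of_abs_lt_one ?_
  rw [abs_of_nonneg ENNReal.toReal_nonneg]
  exact toReal_lt_one (hw c)

/-- Upper half of Pólya's formula `∑ₛ ∏ w = exp (∑ₖ (∑ wᵏ) / k)`. -/
lemma tsum_multiset_le_exp (w : α → ℝ≥0∞) (hw : ∀ c, w c < 1) (τ : ℕ → ℝ)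
    (hτ0 : ∀ k, 0 ≤ τ k)
    (hτ : ∀ k, ∑' c, w c ^ (k + 1) ≤ ENNReal.ofReal (τ k))
    (hs : Summable fun k : ℕ => τ k / (k + 1)) :
    ∑' s : Multiset α, (s.map w).prod ≤ ENNReal.ofReal (Real.exp (∑' k : ℕ, τ k / (k + 1))) := by
  refine tsum_multiset_le w _ fun A => ?_
  rw [prod_geometric_eq w hw]
  refine ENNReal.ofReal_le_ofReal (Real.exp_le_exp.2 ?_)
  refine hasSum_le (fun k => ?_) (hasSum_log_sum w hw A) hs.hasSum
  refine div_le_div_of_nonneg_right ?_ (by positivity)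
  have h1 : ∑ c ∈ A, w c ^ (k + 1) ≤ ENNReal.ofReal (τ k) :=
    (ENNReal.sum_le_tsum A).trans (hτ k)
  have h2 := ENNReal.toReal_mono ENNReal.ofReal_ne_top h1
  rw [ENNReal.toReal_ofReal (hτ0 k),
    ENNReal.toReal_sum fun c _ => ENNReal.pow_ne_top (hw c).ne_top] at h2
  simpa using h2

/-- Lower half of Pólya's formula, with finitely many of the terms in the exponent. -/
lemma exp_le_tsum_multiset (w : α → ℝ≥0∞) (hw : ∀ c, w c < 1)
    (hfin : ∀ k : ℕ, ∑' c, w c ^ (k + 1) ≠ ⊤) (K : ℕ) :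
    ENNReal.ofReal (Real.exp (∑ k ∈ Finset.range K, (∑' c, w c ^ (k + 1)).toReal / (k + 1))) ≤
      ∑' s : Multiset α, (s.map w).prod := by
  have hlim : Tendsto (fun A : Finset α => ENNReal.ofReal (Real.exp (∑ k ∈ Finset.range K,
      (∑ c ∈ A, (w c).toReal ^ (k + 1)) / (k + 1)))) atTop (𝓝 (ENNReal.ofReal (Real.exp
        (∑ k ∈ Finset.range K, (∑' c, w c ^ (k + 1)).toReal / (k + 1))))) := by
    refine ENNReal.tendsto_ofReal ((Real.continuous_exp.tendsto _).comp ?_)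
    refine tendsto_finsetSum _ fun k _ => ?_
    refine Tendsto.div_const ?_ _
    have h1 := ENNReal.hasSum_toReal (hfin k)
    simp only [ENNReal.toReal_pow] at h1
    have h2 : (∑' c, w c ^ (k + 1)).toReal = ∑' c, (w c).toReal ^ (k + 1) := by
      rw [ENNReal.tsum_toReal_eq fun c => ENNReal.pow_ne_top (hw c).ne_top]
      simp only [ENNReal.toReal_pow]
    rw [h2]
    exact h1
  refine le_of_tendsto' hlim fun A => ?_
  refine le_trans ?_ (prod_le_tsum_multiset w A)
  rw [prod_geometric_eq w hw]
  refine ENNReal.ofReal_le_ofReal (Real.exp_le_exp.2 ?_)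
  have h1 := hasSum_log_sum w hw A
  exact sum_le_hasSum _ (fun k _ => by positivity) h1

end Multisets

/-! ### The generating function -/

/-- The generating function of rooted trees by vertices and leaves. -/
noncomputable def genFun (x ζ : ℝ≥0∞) : ℝ≥0∞ :=
  ∑' p : ℕ × ℕ, (a p.1 p.2 : ℝ≥0∞) * x ^ p.1 * ζ ^ p.2

/-- The weight of a tree. -/
noncomputable def weight {h : ℕ} (x ζ : ℝ≥0∞) (t : BTree h) : ℝ≥0∞ := x ^ size t * ζ ^ leaves t

/-- The generating function of rooted trees of height at most `h`. -/
noncomputable def genFunB (h : ℕ) (x ζ : ℝ≥0∞) : ℝ≥0∞ := ∑' t : BTree h, weight x ζ t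

lemma genFunB_eq (h : ℕ) (x ζ : ℝ≥0∞) : genFunB h x ζ = ∑' p : ℕ × ℕ,
    (Nat.card {t : BTree h // size t = p.1 ∧ leaves t = p.2} : ℝ≥0∞) * x ^ p.1 * ζ ^ p.2 := by
  rw [genFunB, ← (Equiv.sigmaFiberEquiv fun t : BTree h => (size t, leaves t)).tsum_eq,
    ENNReal.tsum_sigma']
  refine tsum_congr fun p => ?_
  have h1 : ∀ t : {t : BTree h // (size t, leaves t) = p},
      weight x ζ (Equiv.sigmaFiberEquiv (fun t : BTree h => (size t, leaves t)) ⟨p, t⟩) =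
        x ^ p.1 * ζ ^ p.2 := by
    rintro ⟨t, rfl⟩
    rfl
  simp only [h1, ENNReal.tsum_const]
  have e : {t : BTree h // (size t, leaves t) = p} ≃
      {t : BTree h // size t = p.1 ∧ leaves t = p.2} :=
    Equiv.subtypeEquivRight fun t => Prod.ext_iff
  rw [ENat.card_congr e, ENat.card_eq_coe_natCard, mul_assoc]
  simp

lemma genFunB_le (h : ℕ) (x ζ : ℝ≥0∞) : genFunB h x ζ ≤ genFun x ζ := by
  rw [genFunB_eq]
  refine ENNReal.tsum_le_tsum fun p => ?_
  gcongr
  exact card_le_a _ _ _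

lemma tendsto_genFunB (x ζ : ℝ≥0∞) :
    Tendsto (fun h => genFunB h x ζ) atTop (𝓝 (genFun x ζ)) := by
  refine tendsto_order.2 ⟨fun b hb => ?_, fun b hb =>
    Eventually.of_forall fun h => (genFunB_le h x ζ).trans_lt hb⟩
  rw [genFun, ENNReal.tsum_eq_iSup_sum] at hb
  obtain ⟨F, hF⟩ := lt_iSup_iff.1 hb
  filter_upwards [eventually_ge_atTop (F.sup Prod.fst)] with h hh
  refine hF.trans_le ?_
  rw [genFunB_eq]
  refine le_trans (le_of_eq ?_) (ENNReal.sum_le_tsum F)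
  refine Finset.sum_congr rfl fun p hp => ?_
  rw [card_eq_a ((Finset.le_sup (f := Prod.fst) hp).trans hh)]

lemma weight_pow {h : ℕ} (x ζ : ℝ≥0∞) (t : BTree h) (k : ℕ) :
    weight x ζ t ^ k = weight (x ^ k) (ζ ^ k) t := by
  simp only [weight, mul_pow, ← pow_mul, mul_comm]

lemma weight_lt_one {h : ℕ} {x ζ : ℝ≥0∞} (hx : x < 1) (hζ : x * ζ < 1) (t : BTree h) :
    weight x ζ t < 1 := by
  have h1 : leaves t ≤ size t := by
    rw [size_eq]
    exact Nat.le_add_right _ _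
  have h2 : weight x ζ t = x ^ (size t - leaves t) * (x * ζ) ^ leaves t := by
    rw [weight, mul_pow, ← mul_assoc, ← pow_add, Nat.sub_add_cancel h1]
  rw [h2]
  by_cases h0 : leaves t = 0
  · rw [h0, pow_zero, mul_one, Nat.sub_zero]
    exact pow_lt_one₀ zero_le hx (size_pos t).ne'
  · exact (mul_le_of_le_one_left' (pow_le_one₀ zero_le hx.le)).trans_lt
      (pow_lt_one₀ zero_le hζ h0)

lemma weight_node_zero {h : ℕ} (x ζ : ℝ≥0∞) :
    weight x ζ (node (0 : Multiset (BTree h))) = x * ζ := by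
  simp [weight, size, leaves, stat_node, leafWeight]

lemma prod_weight {h : ℕ} (x ζ : ℝ≥0∞) (s : Multiset (BTree h)) :
    (s.map (weight x ζ)).prod = x ^ (s.map size).sum * ζ ^ (s.map leaves).sum := by
  induction s using Multiset.induction_on with
  | empty => simp
  | cons t s ih =>
    simp only [Multiset.map_cons, Multiset.prod_cons, Multiset.sum_cons, ih, pow_add]
    rw [weight]
    ring

lemma weight_node {h : ℕ} (x ζ : ℝ≥0∞) (s : Multiset (BTree h)) (hs : s ≠ 0) :
    weight x ζ (node s) = x * (s.map (weight x ζ)).prod := by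
  rw [prod_weight]
  have h1 : size (node s) = (s.map size).sum + 1 := by
    rw [size, stat_node, add_comm]
  have h2 : leaves (node s) = (s.map leaves).sum := by
    rw [leaves, stat_node]
    have : ¬ s.card = 0 := by simpa using hs
    simp [leafWeight, this]
    rfl
  rw [weight, h1, h2, pow_succ]
  ring

lemma tsum_add_eq_of_eq_off {β : Type} (b : β) (f g : β → ℝ≥0∞) (hfg : ∀ s, s ≠ b → f s = g s) :
    ∑' s, f s + g b = f b + ∑' s, g s := by
  classical
  have h : ∀ s, (if s = b then 0 else f s) = if s = b then 0 else g s := by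
    intro s
    split_ifs with hs
    · rfl
    · exact hfg s hs
  have hf : ∑' s, f s = f b + ∑' s, (if s = b then 0 else f s) :=
    ENNReal.tsum_eq_add_tsum_ite b
  have hg : ∑' s, g s = g b + ∑' s, (if s = b then 0 else g s) :=
    ENNReal.tsum_eq_add_tsum_ite b
  have hfg : ∑' s, (if s = b then 0 else f s) = ∑' s, (if s = b then 0 else g s) :=
    tsum_congr h
  rw [hf, hg, hfg]
  ring

/-- The recursion expressing that a tree is a root with a multiset of subtrees, the one-vertex
tree having a leaf of its own. -/
lemma genFunB_succ (h : ℕ) (x ζ : ℝ≥0∞) : genFunB (h + 1) x ζ + x =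
    x * ζ + x * ∑' s : Multiset (BTree h), (s.map (weight x ζ)).prod := by
  have h1 := tsum_add_eq_of_eq_off (0 : Multiset (BTree h)) (fun s => weight x ζ (node s))
    (fun s => x * (s.map (weight x ζ)).prod) fun s hs => weight_node x ζ s hs
  simp only [Multiset.map_zero, Multiset.prod_zero, mul_one, ENNReal.tsum_mul_left,
    weight_node_zero] at h1
  exact h1

lemma tsum_weight_pow (h : ℕ) (x ζ : ℝ≥0∞) (k : ℕ) :
    ∑' t : BTree h, weight x ζ t ^ k = genFunB h (x ^ k) (ζ ^ k) := by
  simp only [weight_pow]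
  rfl

lemma weight_zero (x ζ : ℝ≥0∞) (t : BTree 0) : weight x ζ t = x * ζ := by
  have h1 : size t = 1 := rfl
  have h2 : leaves t = 1 := rfl
  rw [weight, h1, h2, pow_one, pow_one]

lemma genFunB_zero (x ζ : ℝ≥0∞) : genFunB 0 x ζ = x * ζ := by
  have : Unique (BTree 0) := inferInstanceAs (Unique Unit)
  rw [genFunB, tsum_eq_single default, weight_zero]
  intro t ht
  exact (ht (Subsingleton.elim _ _)).elim

/-- A supersolution of Pólya's functional equation bounds the generating function. -/
lemma genFun_le_of_supersolution {X Z : ℝ} (hX0 : 0 ≤ X) (hX : X < 1) (hZ : 0 ≤ Z)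
    (hXZ : X * Z < 1) (τ : ℕ → ℝ) (hτ0 : ∀ j, 0 ≤ τ j)
    (hs : ∀ j, Summable fun k : ℕ => τ ((j + 1) * (k + 1)) / (k + 1))
    (hτ : ∀ j, (X * Z) ^ (j + 1) + X ^ (j + 1) *
      (Real.exp (∑' k : ℕ, τ ((j + 1) * (k + 1)) / (k + 1)) - 1) ≤ τ (j + 1)) :
    genFun (ENNReal.ofReal X) (ENNReal.ofReal Z) ≤ ENNReal.ofReal (τ 1) := by
  classical
  set x := ENNReal.ofReal X with hx
  set ζ := ENNReal.ofReal Z with hζ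
  have hx1 : x < 1 := by rw [hx]; exact ENNReal.ofReal_lt_one.2 hX
  have hxζ : x * ζ = ENNReal.ofReal (X * Z) := (ENNReal.ofReal_mul hX0).symm
  have hxζ1 : x * ζ < 1 := by rw [hxζ]; exact ENNReal.ofReal_lt_one.2 hXZ
  have key : ∀ h j, genFunB h (x ^ (j + 1)) (ζ ^ (j + 1)) ≤ ENNReal.ofReal (τ (j + 1)) := by
    intro h
    induction h with
    | zero =>
      intro j
      rw [genFunB_zero, ← mul_pow, hxζ, ← ENNReal.ofReal_pow (by positivity)]
      refine ENNReal.ofReal_le_ofReal (le_trans ?_ (hτ j))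
      have h1 : 1 ≤ Real.exp (∑' k : ℕ, τ ((j + 1) * (k + 1)) / (k + 1)) :=
        Real.one_le_exp (tsum_nonneg fun k => div_nonneg (hτ0 _) (by positivity))
      nlinarith [pow_nonneg hX0 (j + 1)]
    | succ h ih =>
      intro j
      have h1 : ∑' s : Multiset (BTree h), (s.map (weight (x ^ (j + 1)) (ζ ^ (j + 1)))).prod ≤
          ENNReal.ofReal (Real.exp (∑' k : ℕ, τ ((j + 1) * (k + 1)) / (k + 1))) := by
        refine tsum_multiset_le_exp _ (weight_lt_one (pow_lt_one₀ zero_le hx1 (by omega)) ?_)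
          (fun k => τ ((j + 1) * (k + 1))) (fun k => hτ0 _) (fun k => ?_) (hs j)
        · rw [← mul_pow]
          exact pow_lt_one₀ zero_le hxζ1 (by omega)
        · rw [tsum_weight_pow, ← pow_mul, ← pow_mul]
          have h2 : (j + 1) * (k + 1) = ((j + 1) * (k + 1) - 1) + 1 := by
            have : 0 < (j + 1) * (k + 1) := by positivity
            omega
          rw [h2]
          exact ih _
      have hxne : x ^ (j + 1) ≠ ⊤ := ENNReal.pow_ne_top hx1.ne_top
      rw [← ENNReal.add_le_add_iff_right hxne, genFunB_succ]
      refine (add_le_add_right (mul_le_mul_right h1 _) _).trans ?_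
      rw [← mul_pow, hxζ, hx, ← ENNReal.ofReal_pow (by positivity), ← ENNReal.ofReal_pow hX0,
        ← ENNReal.ofReal_mul (by positivity), ← ENNReal.ofReal_add (by positivity) (by positivity),
        ← ENNReal.ofReal_add (hτ0 _) (by positivity)]
      refine ENNReal.ofReal_le_ofReal ?_
      have := hτ j
      linarith
  have h1 := le_of_tendsto' (tendsto_genFunB x ζ) fun h => by simpa using key h 0
  exact h1

lemma genFun_pow_le {x ζ : ℝ≥0∞} (hx : x < 1) (hxζ : x * ζ < 1) (j : ℕ) :
    genFun (x ^ (j + 1)) (ζ ^ (j + 1)) ≤ genFun x ζ := by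
  refine le_of_tendsto_of_tendsto' (tendsto_genFunB _ _) (tendsto_genFunB _ _) fun h => ?_
  rw [← tsum_weight_pow]
  refine ENNReal.tsum_le_tsum fun t => ?_
  exact pow_le_of_le_one zero_le (weight_lt_one hx hxζ t).le (by omega)

/-- Where the generating function converges, it is a supersolution of Pólya's functional equation,
truncated to finitely many terms in the exponent. -/
lemma le_genFun_toReal {X Z : ℝ} (hX0 : 0 ≤ X) (hX : X < 1) (hZ : 0 ≤ Z) (hXZ : X * Z < 1)
    (hfin : genFun (ENNReal.ofReal X) (ENNReal.ofReal Z) ≠ ⊤) (j K : ℕ) :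
    (X * Z) ^ (j + 1) + X ^ (j + 1) * (Real.exp (∑ k ∈ Finset.range K,
      (genFun (ENNReal.ofReal X ^ ((j + 1) * (k + 1)))
        (ENNReal.ofReal Z ^ ((j + 1) * (k + 1)))).toReal / (k + 1)) - 1) ≤
      (genFun (ENNReal.ofReal X ^ (j + 1)) (ENNReal.ofReal Z ^ (j + 1))).toReal := by
  classical
  set x := ENNReal.ofReal X with hx
  set ζ := ENNReal.ofReal Z with hζ
  have hx1 : x < 1 := by rw [hx]; exact ENNReal.ofReal_lt_one.2 hX
  have hxζ : x * ζ = ENNReal.ofReal (X * Z) := (ENNReal.ofReal_mul hX0).symm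
  have hxζ1 : x * ζ < 1 := by rw [hxζ]; exact ENNReal.ofReal_lt_one.2 hXZ
  have hfin' : ∀ j, genFun (x ^ (j + 1)) (ζ ^ (j + 1)) ≠ ⊤ := fun j =>
    ((genFun_pow_le hx1 hxζ1 j).trans_lt hfin.lt_top).ne
  have hxne : x ^ (j + 1) ≠ ⊤ := ENNReal.pow_ne_top hx1.ne_top
  have key : ∀ h, (X * Z) ^ (j + 1) + X ^ (j + 1) * (Real.exp (∑ k ∈ Finset.range K,
      (genFunB h (x ^ ((j + 1) * (k + 1))) (ζ ^ ((j + 1) * (k + 1)))).toReal / (k + 1)) - 1) ≤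
      (genFun (x ^ (j + 1)) (ζ ^ (j + 1))).toReal := by
    intro h
    have h1 := exp_le_tsum_multiset (weight (h := h) (x ^ (j + 1)) (ζ ^ (j + 1)))
      (weight_lt_one (pow_lt_one₀ zero_le hx1 (by omega)) (by
        rw [← mul_pow]
        exact pow_lt_one₀ zero_le hxζ1 (by omega))) (fun k => by
        rw [tsum_weight_pow, ← pow_mul, ← pow_mul]
        have h2 : (j + 1) * (k + 1) = ((j + 1) * (k + 1) - 1) + 1 := by
          have : 0 < (j + 1) * (k + 1) := by positivity
          omega
        rw [h2]
        exact ((genFunB_le _ _ _).trans_lt (hfin' _).lt_top).ne) K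
    simp only [tsum_weight_pow, ← pow_mul] at h1
    have h2 : x ^ (j + 1) * ζ ^ (j + 1) + x ^ (j + 1) * ENNReal.ofReal (Real.exp
        (∑ k ∈ Finset.range K, (genFunB h (x ^ ((j + 1) * (k + 1)))
          (ζ ^ ((j + 1) * (k + 1)))).toReal / (k + 1))) ≤
        genFun (x ^ (j + 1)) (ζ ^ (j + 1)) + x ^ (j + 1) := by
      refine (add_le_add_right (mul_le_mul_right h1 _) _).trans ?_
      rw [← genFunB_succ]
      gcongr
      exact genFunB_le _ _ _
    have h3 := ENNReal.toReal_mono (ENNReal.add_ne_top.2 ⟨hfin' j, hxne⟩) h2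
    rw [ENNReal.toReal_add (hfin' j) hxne, ← mul_pow, hxζ, hx, ← ENNReal.ofReal_pow (by positivity),
      ← ENNReal.ofReal_pow hX0, ← ENNReal.ofReal_mul (by positivity),
      ← ENNReal.ofReal_add (by positivity) (by positivity),
      ENNReal.toReal_ofReal (by positivity), ENNReal.toReal_ofReal (by positivity)] at h3
    rw [hx] at hfin' ⊢
    rw [← ENNReal.ofReal_pow hX0 (j + 1)]
    linarith
  refine le_of_tendsto' (x := atTop) (f := fun h => (X * Z) ^ (j + 1) + X ^ (j + 1) *
    (Real.exp (∑ k ∈ Finset.range K, (genFunB h (x ^ ((j + 1) * (k + 1)))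
      (ζ ^ ((j + 1) * (k + 1)))).toReal / (k + 1)) - 1)) ?_ key
  refine Tendsto.const_add _ (Tendsto.const_mul _ (Tendsto.sub_const ?_ _))
  refine (Real.continuous_exp.tendsto _).comp (tendsto_finsetSum _ fun k _ => ?_)
  refine Tendsto.div_const ((ENNReal.tendsto_toReal ?_).comp (tendsto_genFunB _ _)) _
  have h2 : (j + 1) * (k + 1) = ((j + 1) * (k + 1) - 1) + 1 := by
    have : 0 < (j + 1) * (k + 1) := by positivity
    omega
  rw [h2]
  exact hfin' _

/-! ### Certificates for convergence and divergence -/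

/-- The Taylor polynomial of the exponential function with `n` terms. -/
def taylor (n : ℕ) (s : ℚ) : ℚ := ∑ m ∈ Finset.range n, s ^ m / (m.factorial : ℚ)

/-- An upper bound for the exponential function on `[0, 2]`, from a Taylor polynomial at half the
argument. -/
def expUpper (n : ℕ) (s : ℚ) : ℚ :=
  (taylor n (s / 2) + (s / 2) ^ n * (n + 1) / (n.factorial * n)) ^ 2

lemma taylor_le_exp {s : ℚ} (hs : 0 ≤ s) (n : ℕ) : (taylor n s : ℝ) ≤ Real.exp s := by
  have h := Real.sum_le_exp_of_nonneg (x := (s : ℝ)) (by exact_mod_cast hs) n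
  simpa [taylor] using h

lemma exp_le_expUpper {s : ℚ} (hs : 0 ≤ s) (hs2 : s ≤ 2) {n : ℕ} (hn : 0 < n) :
    Real.exp s ≤ (expUpper n s : ℝ) := by
  have h0 : (0 : ℝ) ≤ ((s / 2 : ℚ) : ℝ) := by exact_mod_cast (by positivity : (0 : ℚ) ≤ s / 2)
  have h1 : ((s / 2 : ℚ) : ℝ) ≤ 1 := by exact_mod_cast (by linarith : s / 2 ≤ 1)
  have h2 := Real.exp_bound' h0 h1 hn
  have h3 : Real.exp (s : ℝ) = Real.exp ((s / 2 : ℚ) : ℝ) ^ 2 := by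
    rw [← Real.exp_nat_mul]
    push_cast
    ring_nf
  rw [h3, expUpper, Rat.cast_pow]
  refine pow_le_pow_left₀ (Real.exp_pos _).le (h2.trans (le_of_eq ?_)) 2
  simp [taylor]

/-- The `j`-th entry, for `j ≥ 1`, of a list of multiples of `10⁻¹⁵`; zero beyond the list. -/
def entry (l : List ℕ) (j : ℕ) : ℚ := (l.getD (j - 1) 0 : ℚ) / 10 ^ 15

/-- The exponent of Pólya's functional equation for the index `j + 1`, with the entries of `l` as
values of the generating function. -/
def exponent (l : List ℕ) (j : ℕ) : ℚ :=
  ∑ k ∈ Finset.range l.length, entry l ((j + 1) * (k + 1)) / (k + 1)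

lemma entry_nonneg (l : List ℕ) (j : ℕ) : 0 ≤ entry l j := by
  unfold entry
  positivity

lemma entry_eq_zero (l : List ℕ) {j : ℕ} (hj : l.length < j) : entry l j = 0 := by
  rw [entry, List.getD_eq_default _ _ (by omega)]
  simp

lemma exponent_nonneg (l : List ℕ) (j : ℕ) : 0 ≤ exponent l j :=
  Finset.sum_nonneg fun _ _ => div_nonneg (entry_nonneg _ _) (by positivity)

/-- The entries of `l`, continued by twice the powers of `x ζ`, form a supersolution of Pólya's
functional equation; `ε` bounds the contribution of the continuation. -/
def UpperCert (x ζ ε : ℚ) (l : List ℕ) : Prop :=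
  (0 ≤ x ∧ 0 ≤ ζ ∧ x ≤ 1 / 3 ∧ x * ζ ≤ 1 / 2 ∧ 1 ≤ l.length ∧
    2 * (x * ζ) ^ (l.length + 1) / (1 - x * ζ) ≤ ε) ∧
  ∀ j : ℕ, j < l.length → exponent l j + ε ≤ 2 ∧
    (x * ζ) ^ (j + 1) + x ^ (j + 1) * (expUpper 16 (exponent l j + ε) - 1) ≤ entry l (j + 1)

instance (x ζ ε : ℚ) (l : List ℕ) : Decidable (UpperCert x ζ ε l) := by
  unfold UpperCert
  infer_instance

/-- The entries of `l`, the first of them zero, are lower bounds for the values of the generating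
function that prevent its convergence. -/
def LowerCert (x ζ : ℚ) (l : List ℕ) : Prop :=
  (0 < x ∧ 0 ≤ ζ ∧ x ≤ 1 / 2 ∧ x * ζ < 1 ∧ 1 ≤ l.length ∧ entry l 1 = 0 ∧
    1 < x * taylor 22 (1 + x * ζ - x + exponent l 0)) ∧
  ∀ j : ℕ, j < l.length → 1 ≤ j → exponent l j ≤ 1 ∧
    entry l (j + 1) ≤ (x * ζ) ^ (j + 1) + x ^ (j + 1) * (taylor 22 (exponent l j) - 1)

instance (x ζ : ℚ) (l : List ℕ) : Decidable (LowerCert x ζ l) := by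
  unfold LowerCert
  infer_instance

/-- `exp (∑ 2 yᵏ / k) = (1 - y)⁻²` is at most `1 + 6 y` for `y ≤ 1 / 2`. -/
lemma exp_tail_le {y : ℝ} (hy0 : 0 ≤ y) (hy : y ≤ 1 / 2) :
    Real.exp (∑' k : ℕ, 2 * y ^ (k + 1) / (k + 1)) ≤ 1 + 6 * y := by
  have h1 := (Real.hasSum_pow_div_log_of_abs_lt_one
    (x := y) (by rw [abs_of_nonneg hy0]; linarith)).mul_left 2
  have h2 : ∑' k : ℕ, 2 * y ^ (k + 1) / (k + 1) = 2 * -Real.log (1 - y) := by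
    rw [← h1.tsum_eq]
    exact tsum_congr fun k => mul_div_assoc _ _ _
  have h3 : 0 < 1 - y := by linarith
  rw [h2, mul_neg, Real.exp_neg, mul_comm, Real.exp_mul, Real.exp_log h3,
    inv_le_iff_one_le_mul₀ (by positivity)]
  norm_num
  nlinarith [mul_nonneg hy0 (by linarith : (0 : ℝ) ≤ 1 / 2 - y),
    mul_nonneg (mul_nonneg hy0 hy0) (by linarith : (0 : ℝ) ≤ 1 / 2 - y)]

lemma genFun_ne_top_of_upperCert {x ζ ε : ℚ} {l : List ℕ} (hc : UpperCert x ζ ε l) :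
    genFun (ENNReal.ofReal x) (ENNReal.ofReal ζ) ≠ ⊤ := by
  obtain ⟨⟨hx0, hζ0, hx, hxζ, hl, hε⟩, hcert⟩ := hc
  set J := l.length with hJ
  obtain ⟨X, hX⟩ : ∃ X : ℝ, X = (x : ℝ) := ⟨_, rfl⟩
  obtain ⟨Z, hZ⟩ : ∃ Z : ℝ, Z = (ζ : ℝ) := ⟨_, rfl⟩
  rw [← hX, ← hZ]
  have hX0 : 0 ≤ X := by rw [hX]; exact_mod_cast hx0
  have hZ0 : 0 ≤ Z := by rw [hZ]; exact_mod_cast hζ0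
  have hX3 : X ≤ 1 / 3 := by
    have : ((x : ℚ) : ℝ) ≤ ((1 / 3 : ℚ) : ℝ) := by exact_mod_cast hx
    rw [hX]
    simpa using this
  have hXZ : X * Z ≤ 1 / 2 := by
    have : ((x * ζ : ℚ) : ℝ) ≤ ((1 / 2 : ℚ) : ℝ) := by exact_mod_cast hxζ
    rw [hX, hZ]
    simpa using this
  set q := X * Z with hq
  have hq0 : 0 ≤ q := mul_nonneg hX0 hZ0
  let g : ℕ → ℝ := fun i => if i ≤ J then (entry l i : ℝ) else 0
  let f : ℕ → ℝ := fun i => if i ≤ J then 0 else 2 * q ^ i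
  let τ : ℕ → ℝ := fun i => g i + f i
  have hg0 : ∀ i, 0 ≤ g i := fun i => by
    simp only [g]
    split_ifs
    · exact_mod_cast entry_nonneg l i
    · exact le_rfl
  have hf0 : ∀ i, 0 ≤ f i := fun i => by
    simp only [f]
    split_ifs
    · exact le_rfl
    · positivity
  have hτ0 : ∀ i, 0 ≤ τ i := fun i => add_nonneg (hg0 i) (hf0 i)
  -- the continuation sums to a geometric series
  have hf : HasSum f (2 * q ^ (J + 1) / (1 - q)) := by
    rw [← hasSum_nat_add_iff' (J + 1)]
    have h1 : ∑ i ∈ Finset.range (J + 1), f i = 0 := Finset.sum_eq_zero fun i hi => by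
      have : i ≤ J := by
        have := Finset.mem_range.1 hi
        omega
      simp [f, this]
    rw [h1, sub_zero]
    have h2 := (hasSum_geometric_of_lt_one hq0 (by linarith : q < 1)).mul_left (2 * q ^ (J + 1))
    rw [← div_eq_mul_inv] at h2
    have h3 : (fun i => f (i + (J + 1))) = fun i => 2 * q ^ (J + 1) * q ^ i := by
      funext i
      have : ¬ i + (J + 1) ≤ J := by omega
      simp only [f, this, if_false]
      ring
    rw [h3]
    exact h2
  have hinj : ∀ j, Function.Injective fun k : ℕ => (j + 1) * (k + 1) := fun j k k' h => by
    have := Nat.eq_of_mul_eq_mul_left (Nat.succ_pos j) h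
    omega
  have hfs : ∀ j, Summable fun k : ℕ => f ((j + 1) * (k + 1)) := fun j =>
    hf.summable.comp_injective (hinj j)
  have hle : ∀ j k : ℕ, f ((j + 1) * (k + 1)) / (k + 1) ≤ f ((j + 1) * (k + 1)) := fun j k =>
    div_le_self (hf0 _) (by linarith [(Nat.cast_nonneg k : (0 : ℝ) ≤ k)])
  have hfs' : ∀ j, Summable fun k : ℕ => f ((j + 1) * (k + 1)) / (k + 1) := fun j =>
    Summable.of_nonneg_of_le (fun k => div_nonneg (hf0 _) (by positivity)) (hle j) (hfs j)
  have hfε : ∀ j, ∑' k : ℕ, f ((j + 1) * (k + 1)) / (k + 1) ≤ (ε : ℝ) := by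
    intro j
    have h1 : ∑' k : ℕ, f ((j + 1) * (k + 1)) / (k + 1) ≤ ∑' i, f i :=
      (hfs' j).tsum_le_tsum_of_inj _ (hinj j) (fun i _ => hf0 i) (hle j) hf.summable
    refine h1.trans ?_
    rw [hf.tsum_eq]
    have h2 : ((2 * (x * ζ) ^ (l.length + 1) / (1 - x * ζ) : ℚ) : ℝ) ≤ (ε : ℝ) := by
      exact_mod_cast hε
    push_cast at h2
    rw [hq, hX, hZ]
    exact h2
  have hgs : ∀ j, HasSum (fun k : ℕ => g ((j + 1) * (k + 1)) / (k + 1)) (exponent l j : ℝ) := by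
    intro j
    have h1 : (exponent l j : ℝ) =
        ∑ k ∈ Finset.range J, g ((j + 1) * (k + 1)) / (k + 1) := by
      rw [exponent, Rat.cast_sum]
      refine Finset.sum_congr rfl fun k _ => ?_
      simp only [g]
      split_ifs with h
      · push_cast
        rfl
      · rw [entry_eq_zero l (by omega)]
        simp
    rw [h1]
    refine hasSum_sum_of_ne_finset_zero fun k hk => ?_
    have h2 : J ≤ k := by simpa using hk
    have h3 : ¬ (j + 1) * (k + 1) ≤ J := by nlinarith
    simp [g, h3]
  have hτs : ∀ j, Summable fun k : ℕ => τ ((j + 1) * (k + 1)) / (k + 1) := fun j => by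
    simp only [τ, add_div]
    exact (hgs j).summable.add (hfs' j)
  have hτe : ∀ j, ∑' k : ℕ, τ ((j + 1) * (k + 1)) / (k + 1) ≤ ((exponent l j + ε : ℚ) : ℝ) := by
    intro j
    simp only [τ, add_div]
    rw [(hgs j).summable.tsum_add (hfs' j), (hgs j).tsum_eq, Rat.cast_add]
    exact add_le_add_right (hfε j) _
  have hε0 : 0 ≤ ε := by
    refine le_trans (div_nonneg (by positivity) (by linarith)) hε
  refine ne_top_of_le_ne_top ENNReal.ofReal_ne_top (genFun_le_of_supersolution hX0 (by linarith)
    hZ0 (by linarith) τ hτ0 hτs fun j => ?_)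
  by_cases hj : j < J
  · obtain ⟨h1, h2⟩ := hcert j hj
    have h3 : τ (j + 1) = (entry l (j + 1) : ℝ) := by
      have : j + 1 ≤ J := hj
      simp [τ, g, f, this]
    have h4 : ((x : ℝ) * ζ) ^ (j + 1) + (x : ℝ) ^ (j + 1) *
        ((expUpper 16 (exponent l j + ε) : ℝ) - 1) ≤ (entry l (j + 1) : ℝ) := by
      exact_mod_cast h2
    rw [h3]
    rw [← hX, ← hZ] at h4
    refine le_trans ?_ h4
    have h5 := (Real.exp_le_exp.2 (hτe j)).trans
      (exp_le_expUpper (add_nonneg (exponent_nonneg l j) hε0) h1 (by norm_num : 0 < 16))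
    have h6 : 0 ≤ X ^ (j + 1) := by positivity
    have h7 := mul_le_mul_of_nonneg_left (sub_le_sub_right h5 1) h6
    exact add_le_add_right h7 _
  · have hτj : ∀ k, τ ((j + 1) * (k + 1)) = 2 * (q ^ (j + 1)) ^ (k + 1) := fun k => by
      have : ¬ (j + 1) * (k + 1) ≤ J := by nlinarith
      simp [τ, g, f, this, pow_mul]
    have h1 : τ (j + 1) = 2 * q ^ (j + 1) := by simpa using hτj 0
    simp only [hτj, h1]
    have hq1 : q ^ (j + 1) ≤ 1 / 2 := (pow_le_of_le_one hq0 (by linarith) (by omega)).trans hXZ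
    have h2 := exp_tail_le (pow_nonneg hq0 (j + 1)) hq1
    have h3 : X ^ (j + 1) ≤ 1 / 6 := by
      have h4 : X ^ (j + 1) ≤ X ^ 2 := pow_le_pow_of_le_one hX0 (by linarith) (by omega)
      nlinarith
    have h5 : 0 ≤ X ^ (j + 1) := by positivity
    have h6 := mul_le_mul_of_nonneg_left (sub_le_sub_right h2 1) h5
    have h7 := mul_le_mul_of_nonneg_right h3 (pow_nonneg hq0 (j + 1))
    linarith

/-- A supersolution of `T = A + B exp T` lies above a subsolution at which the right-hand side has
slope less than one. -/
lemma le_of_subsolution {A B T L : ℝ} (hB : 0 ≤ B) (hT : A + B * Real.exp T ≤ T)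
    (hL : L ≤ A + B * Real.exp L) (hslope : B * Real.exp L < 1) : L ≤ T := by
  have h1 : Real.exp L * (1 + (T - L)) ≤ Real.exp T := by
    have h2 := mul_le_mul_of_nonneg_left (Real.add_one_le_exp (T - L)) (Real.exp_pos L).le
    rw [← Real.exp_add] at h2
    have h3 : L + (T - L) = T := by ring
    rw [h3] at h2
    linarith
  have h4 := mul_le_mul_of_nonneg_left h1 hB
  by_contra h
  have h5 : T < L := not_le.1 h
  nlinarith

lemma genFun_eq_top_of_lowerCert {x ζ : ℚ} {l : List ℕ} (hc : LowerCert x ζ l) :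
    genFun (ENNReal.ofReal x) (ENNReal.ofReal ζ) = ⊤ := by
  obtain ⟨⟨hx0, hζ0, hx, hxζ, hl, hl1, hfinal⟩, hcert⟩ := hc
  by_contra hfin
  obtain ⟨X, hX⟩ : ∃ X : ℝ, X = (x : ℝ) := ⟨_, rfl⟩
  obtain ⟨Z, hZ⟩ : ∃ Z : ℝ, Z = (ζ : ℝ) := ⟨_, rfl⟩
  rw [← hX, ← hZ] at hfin
  have hX0 : 0 < X := by rw [hX]; exact_mod_cast hx0
  have hZ0 : 0 ≤ Z := by rw [hZ]; exact_mod_cast hζ0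
  have hX2 : X ≤ 1 / 2 := by
    have : ((x : ℚ) : ℝ) ≤ ((1 / 2 : ℚ) : ℝ) := by exact_mod_cast hx
    rw [hX]
    simpa using this
  have hXZ : X * Z < 1 := by rw [hX, hZ]; exact_mod_cast hxζ
  set σ : ℕ → ℝ := fun j => (genFun (ENNReal.ofReal X ^ j) (ENNReal.ofReal Z ^ j)).toReal with hσ
  have hσ0 : ∀ j, 0 ≤ σ j := fun j => ENNReal.toReal_nonneg
  obtain ⟨J, hJ⟩ : ∃ J, l.length = J + 1 := ⟨l.length - 1, by omega⟩
  have hsuper : ∀ j, (X * Z) ^ (j + 1) + X ^ (j + 1) * (Real.exp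
      (∑ k ∈ Finset.range (J + 1), σ ((j + 1) * (k + 1)) / (k + 1)) - 1) ≤ σ (j + 1) := fun j =>
    le_genFun_toReal hX0.le (by linarith) hZ0 hXZ hfin j (J + 1)
  -- replacing the values at the proper multiples of `j + 1` by their lower bounds
  have hstep : ∀ j, (∀ i, j + 1 < i → (entry l i : ℝ) ≤ σ i) →
      (X * Z) ^ (j + 1) - X ^ (j + 1) + X ^ (j + 1) *
        Real.exp (σ (j + 1) + ((exponent l j : ℝ) - entry l (j + 1))) ≤ σ (j + 1) := by
    intro j hj
    refine le_trans (le_of_eq_of_le (by ring) (add_le_add_right (mul_le_mul_of_nonneg_left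
      (sub_le_sub_right (Real.exp_le_exp.2 ?_) 1) (by positivity)) _)) (hsuper j)
    rw [exponent, hJ, Finset.sum_range_succ', Finset.sum_range_succ']
    push_cast
    simp only [zero_add, mul_one, div_one, add_sub_cancel_right, add_comm (σ (j + 1))]
    refine add_le_add_left (Finset.sum_le_sum fun k _ => ?_) _
    refine div_le_div_of_nonneg_right (hj _ ?_) (by positivity)
    nlinarith
  have hentry : ∀ d j, 1 ≤ j → l.length ≤ j + d → (entry l (j + 1) : ℝ) ≤ σ (j + 1) := by
    intro d
    induction d with
    | zero =>
      intro j _ hj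
      rw [entry_eq_zero l (by omega)]
      simpa using hσ0 _
    | succ d ih =>
      intro j hj1 hjd
      by_cases hj : j < l.length
      · have h1 := hstep j fun i hi => by
          obtain ⟨i, rfl⟩ : ∃ i', i = i' + 1 := ⟨i - 1, by omega⟩
          exact ih i (by omega) (by omega)
        obtain ⟨h2, h3⟩ := hcert j hj hj1
        have h4 : (entry l (j + 1) : ℝ) ≤ (X * Z) ^ (j + 1) + X ^ (j + 1) *
            ((taylor 22 (exponent l j) : ℝ) - 1) := by
          rw [hX, hZ]
          exact_mod_cast h3
        have h5 := taylor_le_exp (exponent_nonneg l j) 22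
        have h2' : (exponent l j : ℝ) ≤ 1 := by exact_mod_cast h2
        have h6 : X ^ (j + 1) ≤ 1 / 4 := by
          have h7 : X ^ (j + 1) ≤ X ^ 2 := pow_le_pow_of_le_one hX0.le (by linarith) (by omega)
          nlinarith
        have hXj : 0 < X ^ (j + 1) := by positivity
        set R : ℝ := (exponent l j : ℝ) - entry l (j + 1) with hR
        have hexp : ∀ u : ℝ, X ^ (j + 1) * Real.exp R * Real.exp u =
            X ^ (j + 1) * Real.exp (u + R) := fun u => by
          rw [Real.exp_add]
          ring
        have hRL : (entry l (j + 1) : ℝ) + R = exponent l j := by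
          rw [hR]
          ring
        refine le_of_subsolution (A := (X * Z) ^ (j + 1) - X ^ (j + 1))
          (B := X ^ (j + 1) * Real.exp R) (by positivity) ?_ ?_ ?_
        · rw [hexp]
          exact h1
        · rw [hexp, hRL]
          have h8 := mul_le_mul_of_nonneg_left h5 hXj.le
          linarith
        · rw [hexp, hRL]
          have h8 : Real.exp (exponent l j : ℝ) ≤ Real.exp 1 := Real.exp_le_exp.2 h2'
          have h9 := Real.exp_one_lt_d9
          have h10 := Real.exp_pos (exponent l j : ℝ)
          nlinarith
      · rw [entry_eq_zero l (by omega)]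
        simpa using hσ0 _
  have h1 := hstep 0 fun i hi => by
    obtain ⟨i, rfl⟩ : ∃ i', i = i' + 1 := ⟨i - 1, by omega⟩
    exact hentry l.length i (by omega) (by omega)
  simp only [zero_add, pow_one, hl1, Rat.cast_zero, sub_zero] at h1
  -- with `U = σ₁ - x ζ + x` the equation reads `x exp (1 + x ζ - x + S) exp (U - 1) ≤ U`
  have h2 : (0 : ℚ) ≤ 1 + x * ζ - x + exponent l 0 := by
    have := exponent_nonneg l 0
    have := mul_nonneg hx0.le hζ0
    linarith
  have h3 := taylor_le_exp h2 22
  have h4 : (1 : ℝ) < X * (taylor 22 (1 + x * ζ - x + exponent l 0) : ℝ) := by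
    rw [hX]
    exact_mod_cast hfinal
  push_cast at h3
  rw [← hX, ← hZ] at h3
  set U := σ 1 - X * Z + X with hU
  have h5 : σ 1 + (exponent l 0 : ℝ) = (1 + X * Z - X + exponent l 0) + (U - 1) := by
    rw [hU]
    ring
  rw [h5, Real.exp_add] at h1
  set E := Real.exp (1 + X * Z - X + (exponent l 0 : ℝ)) with hE
  have h6 := Real.add_one_le_exp (U - 1)
  have h7 : 1 < X * E := h4.trans_le (mul_le_mul_of_nonneg_left h3 hX0.le)
  have h8 : 0 < Real.exp (U - 1) := Real.exp_pos _
  nlinarith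

/-! ### Numerical certificates -/

/-- A sample point for `√ζ`, to the left of `zA`. -/
def zLeft : ℚ := 121849186 / 10 ^ 8

/-- A sample point for `√ζ`, to the left of `zMid`. -/
def zA : ℚ := 121853186 / 10 ^ 8

/-- The square root of a value of `ζ` close to the optimal one. -/
def zMid : ℚ := 121857186 / 10 ^ 8

/-- A sample point for `√ζ`, to the right of `zMid`. -/
def zB : ℚ := 121861186 / 10 ^ 8

/-- A value of `x` just below the radius of convergence at `ζ = zLeft ^ 2`. -/
def xLeft : ℚ := 28111675819412 / 10 ^ 14

/-- A value of `x` just above the radius of convergence at `ζ = zA ^ 2`. -/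
def xA : ℚ := 28110753057496 / 10 ^ 14

/-- A value of `x` just below the radius of convergence at `ζ = zMid ^ 2`. -/
def xMid : ℚ := 28109830313292 / 10 ^ 14

/-- A value of `x` just above the radius of convergence at `ζ = zB ^ 2`. -/
def xB : ℚ := 28108907629663 / 10 ^ 14

/-- A value of `x √ζ` slightly below the critical one at `zLeft`. -/
def cLeft : ℚ := 34253848156912 / 10 ^ 14

/-- A value of `x √ζ` slightly below the maximum. -/
def cStar : ℚ := 34253848209152 / 10 ^ 14

/-- Upper bounds at `ζ = zMid ^ 2` for the generating function at `(x ^ j, ζ ^ j)`, in units of `10⁻¹⁵`. -/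
def upperListMid : List ℕ :=
  [1136309452110927, 192693781114846, 74509452942535, 30552555112542, 12693320592891,
   5291496725781, 2207923190897, 921512129514, 384635517628, 160548582653, 67014075070,
   27972177232, 11675801666, 4873569925, 2034265855, 849118342, 354428581, 147941239, 61751822,
   25775690, 10758974, 4490880, 1874529, 782444, 326599, 136326, 56904, 23753, 9916, 4140]

/-- Upper bounds at `ζ = zLeft ^ 2` for the generating function at `(x ^ j, ζ ^ j)`, in units of `10⁻¹⁵`. -/
def upperListLeft : List ℕ :=
  [1136263593334617, 192670598728772, 74495110677980, 30544582901832, 12689161744587,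
   5289413707736, 2206908847145, 921028265580, 384408310465, 160443210522, 66965695198,
   27950147992, 11665840552, 4869092392, 2032263467, 848226838, 354033216, 147766509, 61674838,
   25741867, 10744150, 4484398, 1871701, 781212, 326063, 136093, 56804, 23710, 9897, 4132]

/-- Lower bounds at `ζ = zA ^ 2` for the generating function at `(x ^ j, ζ ^ j)`, in units of `10⁻¹⁵`. -/
def lowerListA : List ℕ :=
  [0, 192682190052337, 74502281749053, 30548568904610, 12691241080665, 5290455155491,
   2207415980853, 921270175367, 384521901765, 160495890025, 66989881722, 27961160876,
   11670820241, 4871330730, 2033264451, 848672487, 354230849, 147853849, 61713316, 25758770,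
   10751557, 4487635, 1873111, 781825, 326328, 136207, 56851, 23728, 9903, 4133]

/-- Lower bounds at `ζ = zB ^ 2` for the generating function at `(x ^ j, ζ ^ j)`, in units of `10⁻¹⁵`. -/
def lowerListB : List ℕ :=
  [0, 192705372575294, 74516624607272, 30556541712943, 12695400378133, 5292538467016,
   2208430500837, 921754139255, 384749163324, 160601290844, 67038276354, 27983197561,
   11680785047, 4875810070, 2035267714, 849564410, 354626412, 148028673, 61790343, 25792614,
   10766390, 4494121, 1875942, 783057, 326864, 136439, 56952, 23772, 9922, 4141]

lemma upperCert_mid : UpperCert xMid (zMid ^ 2) (1 / 10 ^ 11) upperListMid := by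
  decide +kernel

lemma upperCert_left : UpperCert xLeft (zLeft ^ 2) (1 / 10 ^ 11) upperListLeft := by
  decide +kernel

lemma lowerCert_a : LowerCert xA (zA ^ 2) lowerListA := by
  decide +kernel

lemma lowerCert_b : LowerCert xB (zB ^ 2) lowerListB := by
  decide +kernel

/-! ### The domain of convergence -/

/-- Convergence of the generating function at `x = exp (u - s)`, `ζ = exp (2 s)`, so that `u` is
the logarithm of `x √ζ`. -/
def Conv (u s : ℝ) : Prop :=
  Summable fun p : ℕ × ℕ => (a p.1 p.2 : ℝ) * Real.exp (u * p.1 + s * (2 * p.2 - p.1))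

lemma exp_term_eq {x ζ : ℝ} (hx : 0 < x) (hζ : 0 < ζ) (n m : ℕ) :
    Real.exp ((Real.log x + Real.log ζ / 2) * n + Real.log ζ / 2 * (2 * m - n)) = x ^ n * ζ ^ m := by
  have h : (Real.log x + Real.log ζ / 2) * n + Real.log ζ / 2 * (2 * m - n) =
      Real.log x * n + Real.log ζ * m := by ring
  rw [h, Real.exp_add, Real.exp_mul, Real.exp_mul, Real.exp_log hx, Real.exp_log hζ,
    Real.rpow_natCast, Real.rpow_natCast]

lemma conv_iff_summable {x ζ : ℝ} (hx : 0 < x) (hζ : 0 < ζ) :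
    Conv (Real.log x + Real.log ζ / 2) (Real.log ζ / 2) ↔
      Summable fun p : ℕ × ℕ => (a p.1 p.2 : ℝ) * x ^ p.1 * ζ ^ p.2 := by
  unfold Conv
  simp only [exp_term_eq hx hζ, mul_assoc]

lemma genFun_ofReal {x ζ : ℝ} (hx : 0 ≤ x) (hζ : 0 ≤ ζ) :
    genFun (ENNReal.ofReal x) (ENNReal.ofReal ζ) =
      ∑' p : ℕ × ℕ, ENNReal.ofReal ((a p.1 p.2 : ℝ) * x ^ p.1 * ζ ^ p.2) := by
  refine tsum_congr fun p => ?_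
  rw [ENNReal.ofReal_mul (by positivity), ENNReal.ofReal_mul (by positivity),
    ENNReal.ofReal_natCast, ENNReal.ofReal_pow hx, ENNReal.ofReal_pow hζ]

lemma summable_iff_genFun {x ζ : ℝ} (hx : 0 ≤ x) (hζ : 0 ≤ ζ) :
    (Summable fun p : ℕ × ℕ => (a p.1 p.2 : ℝ) * x ^ p.1 * ζ ^ p.2) ↔
      genFun (ENNReal.ofReal x) (ENNReal.ofReal ζ) ≠ ⊤ := by
  rw [genFun_ofReal hx hζ]
  refine ⟨fun h => h.tsum_ofReal_ne_top, fun h => ?_⟩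
  refine (ENNReal.summable_toReal h).congr fun p => ?_
  exact ENNReal.toReal_ofReal (by positivity)

lemma conv_iff_genFun {x z : ℚ} (hx : 0 < x) (hz : 0 < z) :
    Conv (Real.log ((x * z : ℚ) : ℝ)) (Real.log (z : ℝ)) ↔
      genFun (ENNReal.ofReal x) (ENNReal.ofReal ((z ^ 2 : ℚ) : ℝ)) ≠ ⊤ := by
  have hx' : (0 : ℝ) < x := by exact_mod_cast hx
  have hz' : (0 : ℝ) < z := by exact_mod_cast hz
  rw [← summable_iff_genFun hx'.le (by positivity), ← conv_iff_summable hx' (by positivity)]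
  have h1 : Real.log ((z ^ 2 : ℚ) : ℝ) / 2 = Real.log z := by
    rw [Rat.cast_pow, Real.log_pow]
    push_cast
    ring
  rw [h1, Rat.cast_mul, Real.log_mul hx'.ne' hz'.ne']

lemma Conv.mono {u u' s : ℝ} (h : Conv u s) (hu : u' ≤ u) : Conv u' s := by
  refine Summable.of_nonneg_of_le (fun p => by positivity) (fun p => ?_) h
  gcongr

/-- The domain of convergence is convex in logarithmic coordinates. -/
lemma Conv.convex {u u' s s' θ : ℝ} (h : Conv u s) (h' : Conv u' s') (h0 : 0 ≤ θ) (h1 : θ ≤ 1) :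
    Conv (θ * u + (1 - θ) * u') (θ * s + (1 - θ) * s') := by
  refine Summable.of_nonneg_of_le (fun p => by positivity) (fun p => ?_)
    ((Summable.mul_left θ h).add (Summable.mul_left (1 - θ) h'))
  have h2 := convexOn_exp.2 (Set.mem_univ (u * p.1 + s * (2 * p.2 - p.1)))
    (Set.mem_univ (u' * p.1 + s' * (2 * p.2 - p.1))) h0 (by linarith : 0 ≤ 1 - θ) (by ring)
  simp only [smul_eq_mul] at h2
  have h3 : (θ * u + (1 - θ) * u') * p.1 + (θ * s + (1 - θ) * s') * (2 * p.2 - p.1) =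
      θ * (u * p.1 + s * (2 * p.2 - p.1)) + (1 - θ) * (u' * p.1 + s' * (2 * p.2 - p.1)) := by ring
  rw [h3]
  have h4 := mul_le_mul_of_nonneg_left h2 (Nat.cast_nonneg (α := ℝ) (a p.1 p.2))
  linarith

lemma log_ratCast_le {p q : ℚ} (hp : 0 < p) (hpq : p ≤ q) : Real.log (p : ℝ) ≤ Real.log (q : ℝ) :=
  Real.log_le_log (by exact_mod_cast hp) (by exact_mod_cast hpq)

lemma log_ratCast_lt {p q : ℚ} (hp : 0 < p) (hpq : p < q) : Real.log (p : ℝ) < Real.log (q : ℝ) :=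
  Real.log_lt_log (by exact_mod_cast hp) (by exact_mod_cast hpq)

lemma conv_mid : Conv (Real.log cStar) (Real.log zMid) :=
  ((conv_iff_genFun (by norm_num [xMid]) (by norm_num [zMid])).2
    (genFun_ne_top_of_upperCert upperCert_mid)).mono
    (log_ratCast_le (by norm_num [cStar]) (by norm_num [cStar, xMid, zMid]))

lemma conv_left : Conv (Real.log cLeft) (Real.log zLeft) :=
  ((conv_iff_genFun (by norm_num [xLeft]) (by norm_num [zLeft])).2
    (genFun_ne_top_of_upperCert upperCert_left)).mono
    (log_ratCast_le (by norm_num [cLeft]) (by norm_num [cLeft, xLeft, zLeft]))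

lemma not_conv_a : ¬ Conv (Real.log cStar) (Real.log zA) := fun h =>
  (conv_iff_genFun (x := xA) (by norm_num [xA]) (by norm_num [zA])).1
    (h.mono (log_ratCast_le (by norm_num [xA, zA]) (by norm_num [cStar, xA, zA])))
    (genFun_eq_top_of_lowerCert lowerCert_a)

lemma not_conv_b : ¬ Conv (Real.log cStar) (Real.log zB) := fun h =>
  (conv_iff_genFun (x := xB) (by norm_num [xB]) (by norm_num [zB])).1
    (h.mono (log_ratCast_le (by norm_num [xB, zB]) (by norm_num [cStar, xB, zB])))
    (genFun_eq_top_of_lowerCert lowerCert_b)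

lemma Conv.exists_of_le {u u' s s' t : ℝ} (h : Conv u s) (h' : Conv u' s') (hs : s ≤ t)
    (hs' : t ≤ s') : Conv (min u u') t := by
  rcases eq_or_lt_of_le (hs.trans hs') with h1 | h1
  · obtain rfl : t = s := le_antisymm (h1 ▸ hs') hs
    exact h.mono (min_le_left _ _)
  · have h2 := h.convex (θ := (s' - t) / (s' - s)) h' (div_nonneg (by linarith) (by linarith))
      (div_le_one_of_le₀ (by linarith) (by linarith))
    have h3 : s' - s ≠ 0 := by linarith
    have h4 : (s' - t) / (s' - s) * s + (1 - (s' - t) / (s' - s)) * s' = t := by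
      field_simp
      ring
    rw [h4] at h2
    refine h2.mono ?_
    set θ := (s' - t) / (s' - s)
    have h5 : 0 ≤ θ := div_nonneg (by linarith) (by linarith)
    have h6 : θ ≤ 1 := div_le_one_of_le₀ (by linarith) (by linarith)
    nlinarith [min_le_left u u', min_le_right u u']

/-- To the left of `zA` the critical value of `x √ζ` is smaller than at `zMid`. -/
lemma Conv.lt_of_le {u s : ℝ} (h : Conv u s) (hs : s ≤ Real.log zA) : u < Real.log cStar := by
  by_contra hu
  refine not_conv_a ?_
  have h1 := h.exists_of_le conv_mid hs (log_ratCast_le (by norm_num [zA]) (by norm_num [zA, zMid]))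
  rwa [min_eq_right (not_lt.1 hu)] at h1

lemma Conv.lt_of_ge {u s : ℝ} (h : Conv u s) (hs : Real.log zB ≤ s) : u < Real.log cStar := by
  by_contra hu
  refine not_conv_b ?_
  have h1 := conv_mid.exists_of_le h
    (log_ratCast_le (by norm_num [zMid]) (by norm_num [zB, zMid])) hs
  rwa [min_eq_left (not_lt.1 hu)] at h1

/-- Between `zA` and `zB` the critical value of `x √ζ` is bounded by extrapolation from `zLeft` and
`zA`, as its logarithm is a concave function. -/
lemma Conv.le_of_mem {u s : ℝ} (h : Conv u s) (hs : Real.log zA ≤ s) (hs' : s ≤ Real.log zB) :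
    u ≤ 3 * Real.log cStar - 2 * Real.log cLeft := by
  by_contra hu
  have hu := not_le.1 hu
  have hA : Real.log zLeft < Real.log zA :=
    log_ratCast_lt (by norm_num [zLeft]) (by norm_num [zLeft, zA])
  have hc : Real.log cLeft ≤ Real.log cStar :=
    log_ratCast_le (by norm_num [cLeft]) (by norm_num [cLeft, cStar])
  -- the points are equally spaced, so this is `1 + 3 t ≤ (1 + t) ^ 3`
  have hB : Real.log zB + 2 * Real.log zLeft ≤ 3 * Real.log zA := by
    have h1 := log_ratCast_le (p := zB * zLeft ^ 2) (q := zA ^ 3) (by norm_num [zB, zLeft])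
      (by norm_num [zB, zLeft, zA])
    have h2 : (zB : ℝ) ≠ 0 := by norm_num [zB]
    have h3 : (zLeft : ℝ) ≠ 0 := by norm_num [zLeft]
    push_cast at h1
    rw [Real.log_mul h2 (pow_ne_zero 2 h3), Real.log_pow, Real.log_pow] at h1
    push_cast at h1
    linarith
  set θ := (Real.log zA - Real.log zLeft) / (s - Real.log zLeft) with hθ
  have hpos : 0 < s - Real.log zLeft := by linarith
  have h0 : 1 / 3 ≤ θ := by
    rw [hθ, le_div_iff₀ hpos]
    linarith
  have h1 : θ ≤ 1 := div_le_one_of_le₀ (by linarith) hpos.le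
  have h2 := h.convex conv_left (by linarith : 0 ≤ θ) h1
  have h3 : θ * s + (1 - θ) * Real.log zLeft = Real.log zA := by
    rw [hθ]
    field_simp
    ring
  rw [h3] at h2
  refine not_conv_a (h2.mono ?_)
  nlinarith

/-- No convergence for `x √ζ > 1 / 2.91938`. -/
lemma Conv.le {u s : ℝ} (h : Conv u s) : u ≤ Real.log (1 / 2.91938) := by
  have h1 : Real.log cStar ≤ Real.log (1 / 2.91938) := by
    refine Real.log_le_log (by norm_num [cStar]) ?_
    norm_num [cStar]
  have h2 : 3 * Real.log cStar - 2 * Real.log cLeft ≤ Real.log (1 / 2.91938) := by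
    have h3 : (cLeft : ℝ) ≠ 0 := by norm_num [cLeft]
    have h4 : Real.log ((cStar : ℝ) ^ 3) ≤ Real.log (1 / 2.91938 * (cLeft : ℝ) ^ 2) := by
      refine Real.log_le_log (by norm_num [cStar]) ?_
      norm_num [cStar, cLeft]
    rw [Real.log_mul (by norm_num) (pow_ne_zero 2 h3), Real.log_pow, Real.log_pow] at h4
    push_cast at h4
    linarith
  rcases le_total s (Real.log zA) with h3 | h3
  · exact (h.lt_of_le h3).le.trans h1
  · rcases le_total s (Real.log zB) with h4 | h4
    · exact (h.le_of_mem h3 h4).trans h2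
    · exact (h.lt_of_ge h4).le.trans h1

/-! ### The constant -/

lemma mul_sqrt_le {x ζ c : ℝ} (hx : 0 < x) (hζ : 0 < ζ) (hc : 0 < c) :
    x * √ζ ≤ c ↔ Real.log x + Real.log ζ / 2 ≤ Real.log c := by
  rw [← Real.log_sqrt hζ.le, ← Real.log_mul hx.ne' (Real.sqrt_pos.2 hζ).ne',
    Real.log_le_log_iff (mul_pos hx (Real.sqrt_pos.2 hζ)) hc]

/-- The set whose supremum is the radius of convergence. -/
def convSet (ζ : ℝ) : Set ℝ :=
  {x : ℝ | 0 ≤ x ∧ Summable fun p : ℕ × ℕ => (a p.1 p.2 : ℝ) * x ^ p.1 * ζ ^ p.2}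

lemma le_of_mem_convSet {ζ x : ℝ} (hζ : 0 < ζ) (hx : x ∈ convSet ζ) :
    x * √ζ ≤ 1 / 2.91938 := by
  rcases hx.1.eq_or_lt with h0 | h0
  · rw [← h0]
    norm_num
  · exact (mul_sqrt_le h0 hζ (by norm_num)).2 ((conv_iff_summable h0 hζ).2 hx.2).le

lemma bddAbove_convSet {ζ : ℝ} (hζ : 0 < ζ) : BddAbove (convSet ζ) :=
  ⟨1 / 2.91938 / √ζ, fun _ hx => (le_div_iff₀ (Real.sqrt_pos.2 hζ)).2 (le_of_mem_convSet hζ hx)⟩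

lemma r_mul_sqrt_le {ζ : ℝ} (hζ : 0 < ζ) : r ζ * √ζ ≤ 1 / 2.91938 := by
  rw [← le_div_iff₀ (Real.sqrt_pos.2 hζ)]
  exact Real.sSup_le (fun x hx => (le_div_iff₀ (Real.sqrt_pos.2 hζ)).2 (le_of_mem_convSet hζ hx))
    (by positivity)

lemma bddAbove_r_image : BddAbove ((fun ζ : ℝ => r ζ * √ζ) '' Set.Ioi 0) :=
  ⟨1 / 2.91938, by
    rintro _ ⟨ζ, hζ, rfl⟩
    exact r_mul_sqrt_le hζ⟩

lemma Conv.exp_le_x₀ {u s : ℝ} (h : Conv u s) : Real.exp u ≤ x₀ := by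
  have hζ : 0 < Real.exp (2 * s) := Real.exp_pos _
  have hx : 0 < Real.exp (u - s) := Real.exp_pos _
  have h1 : Real.exp (u - s) ∈ convSet (Real.exp (2 * s)) := by
    refine ⟨hx.le, (conv_iff_summable hx hζ).1 ?_⟩
    have h2 : u - s + 2 * s / 2 = u := by ring
    have h3 : 2 * s / 2 = s := by ring
    rwa [Real.log_exp, Real.log_exp, h2, h3]
  have h2 : Real.exp (u - s) ≤ r (Real.exp (2 * s)) := le_csSup (bddAbove_convSet hζ) h1
  have h3 : r (Real.exp (2 * s)) * √(Real.exp (2 * s)) ≤ x₀ :=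
    le_csSup bddAbove_r_image ⟨_, hζ, rfl⟩
  refine le_trans ?_ h3
  have h4 : √(Real.exp (2 * s)) = Real.exp s := by
    rw [two_mul, Real.exp_add, Real.sqrt_mul_self (Real.exp_pos _).le]
  rw [h4]
  calc Real.exp u = Real.exp (u - s) * Real.exp s := by rw [← Real.exp_add]; ring_nf
    _ ≤ _ := mul_le_mul_of_nonneg_right h2 (Real.exp_pos _).le

lemma x₀_le : x₀ ≤ 1 / 2.91938 := by
  refine Real.sSup_le ?_ (by norm_num)
  rintro _ ⟨ζ, hζ, rfl⟩
  exact r_mul_sqrt_le hζ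

lemma cStar_le_x₀ : (cStar : ℝ) ≤ x₀ := by
  have h := conv_mid.exp_le_x₀
  rwa [Real.exp_log (by norm_num [cStar])] at h

lemma x₀_pos : 0 < x₀ := lt_of_lt_of_le (by norm_num [cStar]) cStar_le_x₀

lemma C₁_bounds : (2.9193800 : ℝ) ≤ C₁ ∧ C₁ < (2.9193801 : ℝ) := by
  constructor
  · rw [C₁, le_div_iff₀ x₀_pos]
    have := x₀_le
    rw [le_div_iff₀ (by norm_num)] at this
    linarith
  · rw [C₁, div_lt_iff₀ x₀_pos]
    have h1 := cStar_le_x₀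
    have h2 : (1 : ℝ) < 2.9193801 * cStar := by norm_num [cStar]
    linarith

lemma log_C₁ : Real.log C₁ = -Real.log x₀ := by
  rw [C₁, one_div, Real.log_inv]

lemma not_conv {u s : ℝ} (hu : -Real.log C₁ < u) : ¬ Conv u s := fun h => by
  have h1 := Real.log_le_log (Real.exp_pos u) h.exp_le_x₀
  rw [Real.log_exp] at h1
  rw [log_C₁, neg_neg] at hu
  linarith

/-- The maximum of `x √ζ` is approached with `ζ ≥ 1`. -/
lemma exists_conv {u : ℝ} (hu : u < -Real.log C₁) : ∃ u' s, u < u' ∧ 0 ≤ s ∧ Conv u' s := by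
  rw [log_C₁, neg_neg, Real.lt_log_iff_exp_lt x₀_pos] at hu
  obtain ⟨_, ⟨ζ, hζ, rfl⟩, hr⟩ := exists_lt_of_lt_csSup
    (Set.Nonempty.image (fun ζ : ℝ => r ζ * √ζ) ⟨1, Set.mem_Ioi.2 one_pos⟩) hu
  have hζ : 0 < ζ := hζ
  have hs := Real.sqrt_pos.2 hζ
  have hr : Real.exp u < r ζ * √ζ := hr
  rw [← div_lt_iff₀ hs] at hr
  have hne : (convSet ζ).Nonempty := by
    by_contra h
    have h1 : r ζ = 0 := by
      change sSup (convSet ζ) = 0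
      rw [Set.not_nonempty_iff_eq_empty.1 h, Real.sSup_empty]
    have : 0 < Real.exp u / √ζ := by positivity
    linarith
  obtain ⟨x, hx, hxu⟩ := exists_lt_of_lt_csSup hne hr
  have hx0 : 0 < x := lt_trans (by positivity) hxu
  have hconv := (conv_iff_summable hx0 hζ).2 hx.2
  have hu' : u < Real.log x + Real.log ζ / 2 := by
    by_contra h
    have h1 := (mul_sqrt_le hx0 hζ (Real.exp_pos u)).2 (by rw [Real.log_exp]; exact not_lt.1 h)
    rw [div_lt_iff₀ hs] at hxu
    linarith
  rcases le_total 0 (Real.log ζ / 2) with h | h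
  · exact ⟨_, _, hu', h, hconv⟩
  · refine ⟨_, _, hu'.trans (hconv.lt_of_le (h.trans ?_)), ?_, conv_mid⟩
    · exact Real.log_nonneg (by norm_num [zA])
    · exact Real.log_nonneg (by norm_num [zMid])

/-! ### Refined counts and stars -/

lemma card_le_sum_card {ι : Type} {n h : ℕ} (Q : BTree h → Prop) (f : BTree h → ι) (s : Finset ι)
    (hf : ∀ t, size t = n → Q t → f t ∈ s) :
    Nat.card {t : BTree h // size t = n ∧ Q t} ≤
      ∑ i ∈ s, Nat.card {t : BTree h // size t = n ∧ f t = i} := by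
  rw [← Finset.sum_coe_sort, ← Nat.card_sigma]
  refine Nat.card_le_card_of_injective
    (fun t => ⟨⟨f t.1, hf t.1 t.2.1 t.2.2⟩, ⟨t.1, t.2.1, rfl⟩⟩) fun t t' htt => ?_
  simp only [Sigma.mk.injEq, Subtype.mk.injEq] at htt
  obtain ⟨h1, h2⟩ := htt
  refine Subtype.ext ?_
  have h3 : ∀ (i j : s) (y : {t : BTree h // size t = n ∧ f t = i})
      (y' : {t : BTree h // size t = n ∧ f t = j}), i = j → HEq y y' → y.1 = y'.1 := by
    rintro i _ y y' rfl hy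
    rw [eq_of_heq hy]
  exact h3 ⟨f t.1, hf t.1 t.2.1 t.2.2⟩ ⟨f t'.1, hf t'.1 t'.2.1 t'.2.2⟩ _ _ (Subtype.ext h1) h2

/-- The number of unordered trees with `n` vertices, of which `e` are non-leaves at even distance
from the root, the root included, and `o` are non-leaves at odd distance. -/
noncomputable def innerCount (n e o : ℕ) : ℕ :=
  Nat.card {t : BTree n // size t = n ∧ (evenInner t, oddInner t) = (e, o)}

lemma ParentTree.ncard_even_eq {n h : ℕ} (R : ParentTree (Fin n)) (hd : ∀ v, R.depth v ≤ h) :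
    {v : Fin n | ¬ R.toLabelled.IsLeaf v ∧
      Even (R.toLabelled.graph.dist R.toLabelled.root v)}.ncard = evenInner (R.code h R.root) := by
  classical
  rw [evenInner, R.stat_code h hd]
  simp only [evenWeight, decide_eq_false_iff_not, isLeaf_iff]
  rw [← Finset.card_filter, ← Set.ncard_coe_finset]
  congr 1
  ext v
  simp [toLabelled, R.dist_eq]

/-- The count does not depend on the bound for the height once this is at least `n`. -/
lemma card_eq_innerCount {n h : ℕ} (hn : n ≤ h) (e o : ℕ) :
    Nat.card {t : BTree h // size t = n ∧ (evenInner t, oddInner t) = (e, o)} =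
      innerCount n e o := by
  have key : ∀ k, n ≤ k →
      Nat.card {t : BTree k // size t = n ∧ (evenInner t, oddInner t) = (e, o)} =
      countTrees n fun t => ({v : Fin n | ¬ t.IsLeaf v ∧ Even (t.graph.dist t.root v)}.ncard,
        t.evenStar) = (e, o) := fun k hk =>
    card_eq_countTrees hk fun R hR => by rw [R.ncard_even_eq hR, R.evenStar_eq hR]
  rw [innerCount, key h hn, key n le_rfl]

/-- The tree with one vertex. -/
def point : (h : ℕ) → BTree h
  | 0 => ()
  | _ + 1 => node 0

lemma stat_point (h : ℕ) (ℓ : ℕ → Bool → ℕ) : stat h ℓ (point h) = ℓ 0 true := by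
  cases h with
  | zero => rfl
  | succ h => simp [point, stat_node]

lemma stat_star (h k : ℕ) (ℓ : ℕ → Bool → ℕ) :
    stat (h + 1) ℓ (node (Multiset.replicate k (point h))) =
      ℓ 0 (decide (k = 0)) + k * ℓ 1 true := by
  rw [stat_node, Multiset.map_replicate, Multiset.sum_replicate, stat_point]
  simp

/-- Stars: one non-leaf vertex, all other vertices being leaves. -/
lemma one_le_innerCount_star (k : ℕ) : 1 ≤ innerCount (k + 2) 1 0 := by
  have : Nonempty {t : BTree (k + 2) // size t = k + 2 ∧ (evenInner t, oddInner t) = (1, 0)} := by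
    refine ⟨node (Multiset.replicate (k + 1) (point (k + 1))), ?_, ?_⟩
    · rw [size, stat_star]
      ring
    · rw [evenInner, oddInner, stat_star, stat_star]
      simp [evenWeight, oddWeight]
  exact Nat.card_pos

lemma innerCount_le_a {n e o m : ℕ} (hm : m + (e + o) = n) : innerCount n e o ≤ a n m := by
  rw [← card_eq_a le_rfl, innerCount]
  refine Nat.card_le_card_of_injective (fun t => ⟨t.1, t.2.1, ?_⟩) fun t t' h =>
    Subtype.ext (congrArg (fun u => u.1) h)
  obtain ⟨t, ht, hteo⟩ := t
  have h1 := size_eq _ t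
  simp only [Prod.mk.injEq] at hteo
  simp only
  omega

lemma a_le_sum_innerCount (n m : ℕ) : a n m ≤
    ∑ p ∈ (Finset.range (n + 1) ×ˢ Finset.range (n + 1)).filter (fun p => m + (p.1 + p.2) = n),
      innerCount n p.1 p.2 := by
  rw [← card_eq_a le_rfl]
  refine card_le_sum_card _ (fun t => (evenInner t, oddInner t)) _ fun t ht htm => ?_
  have h1 := size_eq _ t
  simp only [Finset.mem_filter, Finset.mem_product, Finset.mem_range]
  omega

lemma a_eq_zero {n m : ℕ} (hnm : n < m) : a n m = 0 := by
  have h := a_le_sum_innerCount n m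
  rw [Finset.filter_false_of_mem (fun p _ => by omega)] at h
  simpa using h

/-! ### The upper bound -/

/-- The stars show that `x ζ ≤ 1` in the domain of convergence. -/
lemma Conv.add_nonpos {u s : ℝ} (h : Conv u s) : u + s ≤ 0 := by
  by_contra hus
  have hus : 0 < u + s := not_le.1 hus
  have hinj : Function.Injective fun k : ℕ => (k + 2, k + 1) := fun k k' hk => by
    simp only [Prod.mk.injEq] at hk
    omega
  have h1 := (h.comp_injective hinj).tendsto_atTop_zero
  have h2 : ∀ k : ℕ, Real.exp (2 * u) ≤ ((fun p : ℕ × ℕ => (a p.1 p.2 : ℝ) *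
      Real.exp (u * p.1 + s * (2 * p.2 - p.1))) ∘ fun k : ℕ => (k + 2, k + 1)) k := by
    intro k
    have h3 : (1 : ℝ) ≤ a (k + 2) (k + 1) := by
      exact_mod_cast (one_le_innerCount_star k).trans (innerCount_le_a (by omega))
    have h4 : Real.exp (2 * u) ≤
        Real.exp (u * ((k + 2 : ℕ) : ℝ) + s * (2 * ((k + 1 : ℕ) : ℝ) - ((k + 2 : ℕ) : ℝ))) := by
      refine Real.exp_le_exp.2 ?_
      push_cast
      nlinarith [mul_nonneg (Nat.cast_nonneg (α := ℝ) k) hus.le]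
    exact h4.trans (le_mul_of_one_le_left (Real.exp_pos _).le h3)
  have h3 := ge_of_tendsto' h1 h2
  exact absurd (Real.exp_pos (2 * u)) (not_lt.2 h3)

/-- The Arnold inequalities together allow at most about `N d / 2` non-leaves. -/
lemma four_mul_le_N {d : ℕ} (hd : 1 ≤ d) :
    4 * (((d + 1) / 2 - 1) * ((d + 1) / 2 - 2) / 2) + 1 ≤ N d := by
  have hdiv : ∀ x : ℕ, 4 * (x / 2) ≤ 2 * x := fun x => by omega
  refine (Nat.add_le_add_right (hdiv _) 1).trans ?_
  unfold N
  rcases Nat.even_or_odd' d with ⟨k, rfl | rfl⟩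
  · rw [if_neg (by simp)]
    obtain ⟨k, rfl⟩ : ∃ k', k = k' + 1 := ⟨k - 1, by omega⟩
    have h1 : (2 * (k + 1) + 1) / 2 = k + 1 := by omega
    have h2 : (2 * (k + 1) - 1) * (2 * (k + 1) - 2) / 2 = (2 * k + 1) * k := by
      have : (2 * (k + 1) - 1) * (2 * (k + 1) - 2) = 2 * ((2 * k + 1) * k) := by
        have e1 : 2 * (k + 1) - 1 = 2 * k + 1 := by omega
        have e2 : 2 * (k + 1) - 2 = 2 * k := by omega
        rw [e1, e2]
        ring
      rw [this, Nat.mul_div_cancel_left _ two_pos]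
    rw [h1, h2]
    have h3 : (k + 1 - 1) * (k + 1 - 2) ≤ k * k := Nat.mul_le_mul (by omega) (by omega)
    nlinarith
  · rw [if_pos (by simp)]
    have h1 : (2 * k + 1 + 1) / 2 = k + 1 := by omega
    rw [h1]
    cases k with
    | zero => norm_num
    | succ k =>
      have h2 : (2 * (k + 1) + 1 - 1) * (2 * (k + 1) + 1 - 2) / 2 = (k + 1) * (2 * k + 1) := by
        have : (2 * (k + 1) + 1 - 1) * (2 * (k + 1) + 1 - 2) = 2 * ((k + 1) * (2 * k + 1)) := by
          have e1 : 2 * (k + 1) + 1 - 1 = 2 * (k + 1) := by omega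
          have e2 : 2 * (k + 1) + 1 - 2 = 2 * k + 1 := by omega
          rw [e1, e2]
          ring
        rw [this, Nat.mul_div_cancel_left _ two_pos]
      rw [h2]
      have h3 : k + 1 + 1 - 1 = k + 1 := by omega
      have h4 : k + 1 + 1 - 2 = k := by omega
      rw [h3, h4]
      nlinarith

lemma countTrees_arnold_eq (n k : ℕ) : countTrees n (fun t => t.SatisfiesArnold k) =
    Nat.card {t : BTree n // size t = n ∧ (oddInner t ≤ (k - 1) * (k - 2) / 2 ∧
      evenInner t - 1 ≤ (k - 1) * (k - 2) / 2)} :=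
  (card_eq_countTrees le_rfl fun R hR => by
    rw [LabelledRootedTree.SatisfiesArnold, R.evenStar_eq hR, R.oddStar_eq hR]).symm

/-- In the domain of convergence with `ζ ≥ 1` all trees counted by `A d` have a term of size at
least about `(x √ζ) ^ N d` in the generating function, as half of their vertices are leaves. -/
lemma Conv.exists_A_le {u s : ℝ} (h : Conv u s) (hs : 0 ≤ s) :
    ∃ B : ℝ, 0 < B ∧ ∀ d, 1 ≤ d → (A d : ℝ) ≤ B * Real.exp (-u * N d) := by
  have hus := h.add_nonpos
  have hterm : ∀ p : ℕ × ℕ, 0 ≤ (a p.1 p.2 : ℝ) *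
    Real.exp (u * p.1 + s * (2 * p.2 - p.1)) := fun p => by positivity
  refine ⟨(∑' p : ℕ × ℕ, (a p.1 p.2 : ℝ) * Real.exp (u * p.1 + s * (2 * p.2 - p.1)) + 1) *
    Real.exp s, mul_pos (add_pos_of_nonneg_of_pos (tsum_nonneg hterm) one_pos) (Real.exp_pos _),
    fun d hd => ?_⟩
  set K := ((d + 1) / 2 - 1) * ((d + 1) / 2 - 2) / 2 with hK
  have hN : 4 * K + 1 ≤ N d := four_mul_le_N hd
  let M : ℕ → Finset ℕ := fun n => (Finset.range (n + 1)).filter fun m => n ≤ m + (2 * K + 1)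
  have h1 : A d ≤ ∑ n ∈ Finset.Icc 1 (N d), ∑ m ∈ M n, a n m := by
    refine Finset.sum_le_sum fun n _ => ?_
    rw [countTrees_arnold_eq]
    refine (card_le_sum_card _ leaves (M n) fun t ht hQ => ?_).trans
      (Finset.sum_le_sum fun m _ => card_le_a n n m)
    have h2 := size_eq _ t
    obtain ⟨h3, h4⟩ := hQ
    simp only [M, Finset.mem_filter, Finset.mem_range]
    omega
  have hN' : (4 : ℝ) * K + 1 ≤ N d := by exact_mod_cast hN
  have h2 : (A d : ℝ) * Real.exp (u * N d - s) ≤ ∑' p : ℕ × ℕ, (a p.1 p.2 : ℝ) *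
      Real.exp (u * p.1 + s * (2 * p.2 - p.1)) := by
    have h3 : (A d : ℝ) ≤ ∑ n ∈ Finset.Icc 1 (N d), ∑ m ∈ M n, (a n m : ℝ) := by
      exact_mod_cast h1
    refine (mul_le_mul_of_nonneg_right h3 (Real.exp_pos _).le).trans ?_
    rw [Finset.sum_sigma', Finset.sum_mul]
    refine le_trans ?_ (Summable.sum_le_tsum
      (((Finset.Icc 1 (N d)).sigma M).map (Equiv.sigmaEquivProd ℕ ℕ).toEmbedding)
      (fun p _ => hterm p) h)
    rw [Finset.sum_map]
    refine Finset.sum_le_sum fun p hp => ?_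
    obtain ⟨n, m⟩ := p
    simp only [Finset.mem_sigma, Finset.mem_Icc, M, Finset.mem_filter, Finset.mem_range] at hp
    obtain ⟨⟨-, hnN⟩, -, hnm⟩ := hp
    refine mul_le_mul_of_nonneg_left (Real.exp_le_exp.2 ?_) (Nat.cast_nonneg _)
    have h5 : (n : ℝ) ≤ N d := by exact_mod_cast hnN
    have h6 : (n : ℝ) ≤ m + (2 * K + 1) := by exact_mod_cast hnm
    change u * N d - s ≤ u * n + s * (2 * m - n)
    nlinarith [mul_nonneg hs (by linarith : (0 : ℝ) ≤ m + (2 * K + 1) - n),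
      mul_nonneg hs (by linarith : (0 : ℝ) ≤ N d - (4 * K + 1)),
      mul_nonneg (by linarith : 0 ≤ -(u + s)) (by linarith : (0 : ℝ) ≤ N d - n)]
  have h3 : (A d : ℝ) = (A d : ℝ) * Real.exp (u * N d - s) * (Real.exp s * Real.exp (-u * N d)) := by
    rw [mul_assoc, ← Real.exp_add, ← Real.exp_add]
    have : u * N d - s + (s + -u * N d) = 0 := by ring
    rw [this, Real.exp_zero, mul_one]
  rw [mul_assoc (_ + _)]
  exact h3.le.trans (mul_le_mul_of_nonneg_right (by linarith) (by positivity))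

/-! ### Chains of trees -/

lemma stat_pair {h : ℕ} (ℓ : ℕ → Bool → ℕ) (t t' : BTree h) :
    stat (h + 1) ℓ (node {t, t'}) = ℓ 0 false +
      (stat h (fun k => ℓ (k + 1)) t + stat h (fun k => ℓ (k + 1)) t') := by
  rw [stat_node]
  simp

/-- Two trees of different sizes can be recovered from the tree in which they hang at the root. -/
lemma innerCount_mul_le {n₁ n₂ : ℕ} (hne : n₁ ≠ n₂) (e₁ o₁ e₂ o₂ : ℕ) :
    innerCount n₁ e₁ o₁ * innerCount n₂ e₂ o₂ ≤
      innerCount (n₁ + n₂ + 1) (o₁ + o₂ + 1) (e₁ + e₂) := by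
  rw [← card_eq_innerCount (h := n₁ + n₂) (by omega), ← card_eq_innerCount (h := n₁ + n₂) (by omega),
    ← card_eq_innerCount (h := n₁ + n₂ + 1) le_rfl, ← Nat.card_prod]
  refine Nat.card_le_card_of_injective (fun p => ⟨node {p.1.1, p.2.1}, ?_, ?_⟩) ?_
  · rw [size, stat_pair]
    have h1 := p.1.2.1
    have h2 := p.2.2.1
    simp only [size] at h1 h2
    rw [h1, h2]
    ring
  · have h1 := p.1.2.2
    have h2 := p.2.2.2
    simp only [Prod.mk.injEq, evenInner, oddInner] at h1 h2
    rw [evenInner, oddInner, stat_pair, stat_pair, evenWeight_succ, oddWeight_succ, h1.1, h1.2,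
      h2.1, h2.2]
    simp only [evenWeight, oddWeight, Prod.mk.injEq]
    constructor
    · simp
      ring
    · simp
  · rintro ⟨⟨t₁, h₁, _⟩, ⟨t₂, h₂, _⟩⟩ ⟨⟨t₁', h₁', _⟩, ⟨t₂', h₂', _⟩⟩ h
    have h3 : ({t₁, t₂} : Multiset (BTree (n₁ + n₂))) = {t₁', t₂'} :=
      congrArg (fun u => u.1) h
    have h4 : ∀ (b : BTree (n₁ + n₂)) (b' : BTree (n₁ + n₂)), size b = n₁ → size b' = n₂ →
        Multiset.filter (fun c => size c = n₁) ({b, b'} : Multiset (BTree (n₁ + n₂))) = {b} ∧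
        Multiset.filter (fun c => size c = n₂) ({b, b'} : Multiset (BTree (n₁ + n₂))) = {b'} := by
      intro b b' hb hb'
      simp [Multiset.insert_eq_cons, Multiset.filter_singleton, hb, hb', hne,
        hne.symm]
    have h5 := h4 t₁ t₂ h₁ h₂
    rw [h3, (h4 t₁' t₂' h₁' h₂').1, (h4 t₁' t₂' h₁' h₂').2] at h5
    have h6 := Multiset.singleton_inj.1 h5.1
    have h7 := Multiset.singleton_inj.1 h5.2
    subst h6 h7
    rfl

/-- Hanging two trees with the same parameters one after the other in front of a larger tree adds
equally many non-leaves at even and at odd distances, since the second step exchanges them. -/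
lemma innerCount_two_steps {n N' : ℕ} (hn : n < N') (e₁ o₁ e o : ℕ) :
    innerCount n e₁ o₁ ^ 2 * innerCount N' e o ≤
      innerCount (N' + 2 * (n + 1)) (e + (e₁ + o₁ + 1)) (o + (e₁ + o₁ + 1)) := by
  have h1 := innerCount_mul_le hn.ne e₁ o₁ e o
  have h2 := innerCount_mul_le (n₁ := n) (n₂ := n + N' + 1) (by omega) e₁ o₁
    (o₁ + o + 1) (e₁ + e)
  have e1 : n + (n + N' + 1) + 1 = N' + 2 * (n + 1) := by ring
  have e2 : o₁ + (e₁ + e) + 1 = e + (e₁ + o₁ + 1) := by ring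
  have e3 : e₁ + (o₁ + o + 1) = o + (e₁ + o₁ + 1) := by ring
  rw [e1, e2, e3] at h2
  refine le_trans ?_ h2
  rw [sq, mul_assoc]
  exact Nat.mul_le_mul_left _ h1

lemma innerCount_steps {n N' : ℕ} (hn : n < N') (e₁ o₁ e o p : ℕ) :
    innerCount n e₁ o₁ ^ (2 * p) * innerCount N' e o ≤
      innerCount (N' + p * (2 * (n + 1))) (e + p * (e₁ + o₁ + 1)) (o + p * (e₁ + o₁ + 1)) := by
  induction p with
  | zero => simp
  | succ p ih =>
    have h1 := innerCount_two_steps (n := n) (N' := N' + p * (2 * (n + 1))) (by omega) e₁ o₁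
      (e + p * (e₁ + o₁ + 1)) (o + p * (e₁ + o₁ + 1))
    have e1 : N' + p * (2 * (n + 1)) + 2 * (n + 1) = N' + (p + 1) * (2 * (n + 1)) := by ring
    have e2 : ∀ x, x + p * (e₁ + o₁ + 1) + (e₁ + o₁ + 1) = x + (p + 1) * (e₁ + o₁ + 1) := by
      intro x
      ring
    rw [e1, e2, e2] at h1
    refine le_trans ?_ h1
    have e3 : innerCount n e₁ o₁ ^ (2 * (p + 1)) =
        innerCount n e₁ o₁ ^ 2 * innerCount n e₁ o₁ ^ (2 * p) := by ring
    rw [e3, mul_assoc]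
    exact Nat.mul_le_mul_left _ ih

/-! ### Supply of blocks -/

/-- A family of trees with common parameters `n`, `e`, `o` that has at least `exp (l (n + 1))`
members when a tree is weighted by `exp (s δ)`, where `δ = n - 1 - 2 (e + o)` is one less than
the excess of leaves over non-leaves. -/
def IsBlock (l s : ℝ) (n e o : ℕ) : Prop :=
  1 ≤ n ∧ e + o ≤ n ∧ Real.exp (l * (n + 1) - s * (n - 1 - 2 * (e + o))) ≤ innerCount n e o

/-- Beyond the radius of convergence there is a block. -/
lemma exists_isBlock {l : ℝ} (hl : l < Real.log C₁) (s : ℝ) : ∃ n e o, IsBlock l s n e o := by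
  by_contra hno
  have hno : ∀ n e o, 1 ≤ n → e + o ≤ n →
      (innerCount n e o : ℝ) ≤ Real.exp (l * (n + 1) - s * (n - 1 - 2 * (e + o))) := by
    intro n e o hn heo
    by_contra h
    exact hno ⟨n, e, o, hn, heo, (not_le.1 h).le⟩
  obtain ⟨v, hv1, hv2⟩ := exists_between hl
  refine not_conv (u := -v) (s := s) (by linarith) ?_
  set ρ := Real.exp ((l - v) / 2) with hρ
  have hρ1 : ρ < 1 := by
    rw [hρ, Real.exp_lt_one_iff]
    linarith
  have hρ0 : 0 < ρ := Real.exp_pos _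
  have hsum1 : Summable fun n : ℕ => ((n : ℝ) + 1) ^ 2 * ρ ^ n := by
    have hρn : ‖ρ‖ < 1 := by rwa [Real.norm_of_nonneg hρ0.le]
    have h0 := summable_pow_mul_geometric_of_norm_lt_one 0 hρn
    have h1 := summable_pow_mul_geometric_of_norm_lt_one 1 hρn
    have h2 := summable_pow_mul_geometric_of_norm_lt_one 2 hρn
    refine ((h2.add (h1.mul_left 2)).add h0).congr fun n => ?_
    ring
  have hsum2 : Summable fun n : ℕ => ρ ^ n := summable_geometric_of_lt_one hρ0.le hρ1
  have hsum := ((Summable.mul_of_nonneg hsum1 hsum2 (fun n => by positivity)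
    (fun n => by positivity)).mul_left (Real.exp (l + s)))
  refine Summable.of_nonneg_of_le (fun p => by positivity) (fun p => ?_) hsum
  obtain ⟨n, m⟩ := p
  simp only
  by_cases hnm : n < m ∨ n = 0
  · have h0 : a n m = 0 := by
      rcases hnm with h | rfl
      · exact a_eq_zero h
      · rw [← card_eq_a le_rfl]
        have : IsEmpty {t : BTree 0 // size t = 0 ∧ leaves t = m} :=
          ⟨fun t => (size_pos t.1).ne' t.2.1⟩
        exact Nat.card_of_isEmpty
    rw [h0]
    simp only [Nat.cast_zero, zero_mul]
    positivity
  · push Not at hnm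
    obtain ⟨hmn, hn0⟩ := hnm
    have h1 : (a n m : ℝ) ≤ ((n : ℝ) + 1) ^ 2 * Real.exp (l * (n + 1) - s * (2 * m - n - 1)) := by
      have h2 : (a n m : ℝ) ≤ ∑ p ∈ (Finset.range (n + 1) ×ˢ Finset.range (n + 1)).filter
          (fun p => m + (p.1 + p.2) = n), (innerCount n p.1 p.2 : ℝ) := by
        exact_mod_cast a_le_sum_innerCount n m
      refine h2.trans ((Finset.sum_le_card_nsmul _ _
        (Real.exp (l * (n + 1) - s * (2 * m - n - 1))) fun p hp => ?_).trans ?_)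
      · have h3 := (Finset.mem_filter.1 hp).2
        refine (hno n p.1 p.2 (by omega) (by omega)).trans (le_of_eq ?_)
        have h4 : (n : ℝ) = m + (p.1 + p.2) := by exact_mod_cast h3.symm
        congr 1
        rw [h4]
        ring
      · rw [nsmul_eq_mul]
        refine mul_le_mul_of_nonneg_right ?_ (Real.exp_pos _).le
        have h3 := Finset.card_filter_le (Finset.range (n + 1) ×ˢ Finset.range (n + 1))
          (fun p => m + (p.1 + p.2) = n)
        rw [Finset.card_product, Finset.card_range] at h3
        have h4 : ((((Finset.range (n + 1) ×ˢ Finset.range (n + 1)).filter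
          (fun p => m + (p.1 + p.2) = n)).card : ℕ) : ℝ) ≤ (((n + 1) * (n + 1) : ℕ) : ℝ) := by
          exact_mod_cast h3
        push_cast at h4
        linarith
    have h2 : Real.exp (l * (n + 1) - s * (2 * m - n - 1)) *
        Real.exp (-v * n + s * (2 * m - n)) = Real.exp (l + s) * (ρ ^ n * ρ ^ n) := by
      rw [hρ, ← Real.exp_nat_mul, ← Real.exp_add, ← Real.exp_add, ← Real.exp_add]
      congr 1
      ring
    have h3 : ρ ^ n ≤ ρ ^ m := pow_le_pow_of_le_one hρ0.le hρ1.le hmn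
    calc (a n m : ℝ) * Real.exp (-v * n + s * (2 * m - n))
        ≤ ((n : ℝ) + 1) ^ 2 * Real.exp (l * (n + 1) - s * (2 * m - n - 1)) *
          Real.exp (-v * n + s * (2 * m - n)) :=
          mul_le_mul_of_nonneg_right h1 (Real.exp_pos _).le
      _ = Real.exp (l + s) * (((n : ℝ) + 1) ^ 2 * ρ ^ n * ρ ^ n) := by
          rw [mul_assoc, h2]
          ring
      _ ≤ Real.exp (l + s) * (((n : ℝ) + 1) ^ 2 * ρ ^ n * ρ ^ m) := by gcongr

/-- Growth rate at least `l`, along the sizes `n₀ + R D`, of trees in which, up to a bounded part, at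
most a quarter of the vertices are non-leaves at even distance from the root, and equally many are
non-leaves at odd distance. -/
def HasUnit (l : ℝ) : Prop :=
  ∃ n₀ D ν : ℕ, 1 ≤ n₀ ∧ 0 < D ∧ 4 * ν ≤ D ∧
    ∀ R : ℕ, Real.exp (l * (R * D)) ≤ innerCount (n₀ + R * D) (1 + R * ν) (R * ν)

/-- Copies of two blocks, of total `δ` nonnegative, form a unit. -/
lemma hasUnit_of_blocks {l s₁ s₂ l' : ℝ} {n₁ e₁ o₁ n₂ e₂ o₂ : ℕ} (h₁ : IsBlock l s₁ n₁ e₁ o₁)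
    (h₂ : IsBlock l s₂ n₂ e₂ o₂) (p q : ℕ) (hpq : 0 < p + q)
    (hδ : p * (2 * (e₁ + o₁ + 1)) + q * (2 * (e₂ + o₂ + 1)) ≤ p * (n₁ + 1) + q * (n₂ + 1))
    (hl : l' * (p * (n₁ + 1) + q * (n₂ + 1)) ≤
      p * (l * (n₁ + 1) - s₁ * (n₁ - 1 - 2 * (e₁ + o₁))) +
      q * (l * (n₂ + 1) - s₂ * (n₂ - 1 - 2 * (e₂ + o₂)))) : HasUnit l' := by
  refine ⟨n₁ + n₂ + 2, p * (2 * (n₁ + 1)) + q * (2 * (n₂ + 1)),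
    p * (e₁ + o₁ + 1) + q * (e₂ + o₂ + 1), by omega, ?_, by linarith, fun R => ?_⟩
  · rcases Nat.eq_zero_or_pos p with h | h
    · have : 0 < q := by omega
      positivity
    · positivity
  have hstar := one_le_innerCount_star (n₁ + n₂)
  have hs1 := innerCount_steps (n := n₁) (N' := n₁ + n₂ + 2) (by omega) e₁ o₁ 1 0 (R * p)
  have hs2 := innerCount_steps (n := n₂) (N' := n₁ + n₂ + 2 + R * p * (2 * (n₁ + 1)))
    (by omega) e₂ o₂ (1 + R * p * (e₁ + o₁ + 1)) (0 + R * p * (e₁ + o₁ + 1)) (R * q)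
  have e1 : n₁ + n₂ + 2 + R * p * (2 * (n₁ + 1)) + R * q * (2 * (n₂ + 1)) =
      n₁ + n₂ + 2 + R * (p * (2 * (n₁ + 1)) + q * (2 * (n₂ + 1))) := by ring
  have e2 : 1 + R * p * (e₁ + o₁ + 1) + R * q * (e₂ + o₂ + 1) =
      1 + R * (p * (e₁ + o₁ + 1) + q * (e₂ + o₂ + 1)) := by ring
  have e3 : 0 + R * p * (e₁ + o₁ + 1) + R * q * (e₂ + o₂ + 1) =
      R * (p * (e₁ + o₁ + 1) + q * (e₂ + o₂ + 1)) := by ring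
  rw [e1, e2, e3] at hs2
  have h3 : innerCount n₂ e₂ o₂ ^ (2 * (R * q)) * innerCount n₁ e₁ o₁ ^ (2 * (R * p)) ≤
      innerCount (n₁ + n₂ + 2 + R * (p * (2 * (n₁ + 1)) + q * (2 * (n₂ + 1))))
        (1 + R * (p * (e₁ + o₁ + 1) + q * (e₂ + o₂ + 1)))
        (R * (p * (e₁ + o₁ + 1) + q * (e₂ + o₂ + 1))) := by
    refine le_trans (Nat.mul_le_mul_left _ ?_) hs2
    refine le_trans ?_ hs1
    exact Nat.le_mul_of_pos_right _ hstar
  have h4 : (innerCount n₂ e₂ o₂ : ℝ) ^ (2 * (R * q)) * (innerCount n₁ e₁ o₁ : ℝ) ^ (2 * (R * p)) ≤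
      (innerCount (n₁ + n₂ + 2 + R * (p * (2 * (n₁ + 1)) + q * (2 * (n₂ + 1))))
        (1 + R * (p * (e₁ + o₁ + 1) + q * (e₂ + o₂ + 1)))
        (R * (p * (e₁ + o₁ + 1) + q * (e₂ + o₂ + 1))) : ℕ) := by
    exact_mod_cast h3
  refine le_trans ?_ h4
  have h5 := pow_le_pow_left₀ (Real.exp_pos _).le h₁.2.2 (2 * (R * p))
  have h6 := pow_le_pow_left₀ (Real.exp_pos _).le h₂.2.2 (2 * (R * q))
  refine le_trans ?_ (mul_le_mul h6 h5 (by positivity) (by positivity))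
  rw [← Real.exp_nat_mul, ← Real.exp_nat_mul, ← Real.exp_add, Real.exp_le_exp]
  push_cast
  have h7 := mul_le_mul_of_nonneg_left hl (by positivity : (0 : ℝ) ≤ 2 * R)
  linarith

/-- Units exist for all growth rates below `log C₁`. Along `s = 0, η, 2 η, …` either the first block
has `δ ≥ 0`, or there are consecutive blocks with `δ < 0` and `δ ≥ 0`, since stars are blocks with
`δ ≥ 0` for large `s`; copies of two such blocks are balanced at a small cost. -/
lemma hasUnit {l : ℝ} (hl0 : 0 < l) (hl : l < Real.log C₁) : HasUnit l := by
  obtain ⟨l₁, hl₁, hl₁'⟩ := exists_between hl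
  set η := l₁ - l with hη
  have hη0 : 0 < η := by linarith
  let Pos : ℕ → Prop := fun i => ∃ n e o, IsBlock l₁ (i * η) n e o ∧ 2 * (e + o) + 1 ≤ n
  have hex : ∃ i, Pos i := by
    obtain ⟨i, hi⟩ := exists_nat_ge (2 * l₁ / η)
    rw [div_le_iff₀ hη0] at hi
    refine ⟨i, 7 + 2, 1, 0, ⟨by omega, by omega, ?_⟩, by omega⟩
    have h1 : (1 : ℝ) ≤ innerCount (7 + 2) 1 0 := by exact_mod_cast one_le_innerCount_star 7
    refine le_trans (Real.exp_le_one_iff.2 ?_) h1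
    push_cast
    nlinarith
  classical
  have hi := Nat.find_spec hex
  have hmin := fun j => Nat.find_min (m := j) hex
  set i := Nat.find hex
  obtain ⟨n₂, e₂, o₂, hb₂, hp₂⟩ := hi
  rcases Nat.eq_zero_or_pos i with h0 | hipos
  · refine hasUnit_of_blocks hb₂ hb₂ 1 0 (by omega) (by omega) ?_
    rw [h0]
    push_cast
    nlinarith [mul_nonneg hη0.le (by positivity : (0 : ℝ) ≤ (n₂ : ℝ) + 1)]
  · obtain ⟨j, hj⟩ : ∃ j, i = j + 1 := ⟨i - 1, by omega⟩
    obtain ⟨n₁, e₁, o₁, hb₁⟩ := exists_isBlock hl₁' (j * η)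
    have hn₁ : ¬ 2 * (e₁ + o₁) + 1 ≤ n₁ := fun h => hmin j (by omega) ⟨n₁, e₁, o₁, hb₁, h⟩
    obtain ⟨α, hα⟩ : ∃ α, n₂ = 2 * (e₂ + o₂) + 1 + α := ⟨n₂ - (2 * (e₂ + o₂) + 1), by omega⟩
    obtain ⟨β, hβ⟩ : ∃ β, n₁ + β = 2 * (e₁ + o₁) + 1 := ⟨2 * (e₁ + o₁) + 1 - n₁, by omega⟩
    have hβn : β ≤ n₁ + 1 := by
      have := hb₁.2.1
      omega
    refine hasUnit_of_blocks hb₁ hb₂ α β (by omega) ?_ ?_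
    · have e1 : 2 * (e₁ + o₁ + 1) = n₁ + 1 + β := by omega
      have e2 : n₂ + 1 = 2 * (e₂ + o₂ + 1) + α := by omega
      rw [e1, e2]
      nlinarith
    · have e1 : (n₁ : ℝ) - 1 - 2 * (e₁ + o₁) = -β := by
        have : (n₁ : ℝ) + β = 2 * (e₁ + o₁) + 1 := by exact_mod_cast hβ
        linarith
      have e2 : (n₂ : ℝ) - 1 - 2 * (e₂ + o₂) = α := by
        have : (n₂ : ℝ) = 2 * (e₂ + o₂) + 1 + α := by exact_mod_cast hα
        linarith
      rw [e1, e2, hj]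
      push_cast
      have hβn' : (β : ℝ) ≤ n₁ + 1 := by exact_mod_cast hβn
      have h3 : η * (α * β) ≤ η * (α * (n₁ + 1)) := by gcongr
      have h4 : 0 ≤ η * (β * ((n₂ : ℝ) + 1)) := by positivity
      have h5 : l₁ = l + η := by rw [hη]; ring
      rw [h5]
      nlinarith

/-! ### Asymptotics -/

lemma N_le_sq (d : ℕ) : (N d : ℝ) ≤ (d : ℝ) ^ 2 / 2 + 2 := by
  have h1 : 2 * N d ≤ d * d + 4 := by
    have h2 : 2 * N d ≤ (d - 1) * (d - 2) + 4 := by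
      unfold N
      split_ifs <;> omega
    exact h2.trans (Nat.add_le_add_right (Nat.mul_le_mul (by omega) (by omega)) 4)
  have h3 : (2 : ℝ) * N d ≤ d * d + 4 := by exact_mod_cast h1
  linarith

lemma sq_le_arnold_bound (d : ℕ) : (d : ℝ) ^ 2 / 2 - 3 * d ≤
    4 * (((d + 1) / 2 - 1) * ((d + 1) / 2 - 2) / 2 : ℕ) := by
  rcases Nat.lt_or_ge d 4 with hd | hd
  · have h1 : (d : ℝ) ≤ 4 := by exact_mod_cast hd.le
    have h2 : (0 : ℝ) ≤ d := Nat.cast_nonneg d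
    have h3 : (0 : ℝ) ≤ 4 * (((d + 1) / 2 - 1) * ((d + 1) / 2 - 2) / 2 : ℕ) := by positivity
    nlinarith
  · obtain ⟨k, hk⟩ : ∃ k, (d + 1) / 2 = k + 2 := ⟨(d + 1) / 2 - 2, by omega⟩
    have h1 : (k + 2 - 1) * (k + 2 - 2) = k * (k + 1) := by
      have e1 : k + 2 - 1 = k + 1 := by omega
      have e2 : k + 2 - 2 = k := by omega
      rw [e1, e2, mul_comm]
    have h2 : 2 * (k * (k + 1) / 2) = k * (k + 1) :=
      Nat.mul_div_cancel' (Nat.even_mul_succ_self k).two_dvd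
    have h3 : (2 : ℝ) * (k * (k + 1) / 2 : ℕ) = k * (k + 1) := by exact_mod_cast h2
    have h4 : d ≤ 2 * k + 4 := by omega
    have h5 : (d : ℝ) ≤ 2 * k + 4 := by exact_mod_cast h4
    have h6 : (4 : ℝ) ≤ d := by exact_mod_cast hd
    rw [hk, h1]
    nlinarith [mul_nonneg (by linarith : (0 : ℝ) ≤ 2 * k + 4 - d) (by linarith : (0 : ℝ) ≤ d - 4)]

lemma eventually_const_le {c C : ℝ} (hc : 0 < c) : ∀ᶠ d : ℕ in atTop, C ≤ c * d := by
  have h := (tendsto_natCast_atTop_atTop (R := ℝ)).const_mul_atTop hc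
  exact h.eventually_ge_atTop C

lemma log_C₁_pos : 0 < Real.log C₁ := Real.log_pos (by linarith [C₁_bounds.1])

lemma eventually_log_A_le {ε : ℝ} (hε : 0 < ε) :
    ∀ᶠ d : ℕ in atTop, Real.log (A d) ≤ (Real.log C₁ + ε) * ((d : ℝ) ^ 2 / 2) := by
  have hL := log_C₁_pos
  obtain ⟨u, s, hu, hs, hconv⟩ := exists_conv (u := -(Real.log C₁ + ε / 2)) (by linarith)
  obtain ⟨B, hB, hA⟩ := hconv.exists_A_le hs
  filter_upwards [eventually_const_le (C := Real.log B + 2 * (Real.log C₁ + ε / 2))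
    (by positivity : 0 < ε / 4), eventually_ge_atTop 1] with d hd hd1
  have hd1' : (1 : ℝ) ≤ d := by exact_mod_cast hd1
  rcases Nat.eq_zero_or_pos (A d) with h0 | h0
  · rw [h0, Nat.cast_zero, Real.log_zero]
    positivity
  · have h1 := Real.log_le_log (by exact_mod_cast h0) (hA d hd1)
    rw [Real.log_mul hB.ne' (Real.exp_pos _).ne', Real.log_exp] at h1
    have h2 := N_le_sq d
    have h3 : -u * N d ≤ (Real.log C₁ + ε / 2) * ((d : ℝ) ^ 2 / 2 + 2) :=
      (mul_le_mul_of_nonneg_right (by linarith) (Nat.cast_nonneg _)).trans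
        (mul_le_mul_of_nonneg_left h2 (by positivity))
    have h4 : ε / 4 * (d : ℝ) ≤ ε / 4 * (d : ℝ) ^ 2 := by
      refine mul_le_mul_of_nonneg_left ?_ (by positivity)
      nlinarith
    linarith

lemma innerCount_le_A {d n e o : ℕ} (hn : 1 ≤ n) (hnN : n ≤ N d)
    (he : e - 1 ≤ ((d + 1) / 2 - 1) * ((d + 1) / 2 - 2) / 2)
    (ho : o ≤ ((d + 1) / 2 - 1) * ((d + 1) / 2 - 2) / 2) : innerCount n e o ≤ A d := by
  refine le_trans ?_ (Finset.single_le_sum (f := fun n => countTrees n fun t =>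
    t.SatisfiesArnold ((d + 1) / 2)) (fun _ _ => Nat.zero_le _) (Finset.mem_Icc.2 ⟨hn, hnN⟩))
  rw [countTrees_arnold_eq, innerCount]
  refine Nat.card_le_card_of_injective (fun t => ⟨t.1, t.2.1, ?_⟩) fun t t' h =>
    Subtype.ext (congrArg (fun u => u.1) h)
  obtain ⟨t, ht, hteo⟩ := t
  simp only [Prod.mk.injEq] at hteo
  obtain ⟨rfl, rfl⟩ := hteo
  exact ⟨ho, he⟩

lemma eventually_le_log_A {ε : ℝ} (hε : 0 < ε) :
    ∀ᶠ d : ℕ in atTop, (Real.log C₁ - ε) * ((d : ℝ) ^ 2 / 2) ≤ Real.log (A d) := by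
  have hL := log_C₁_pos
  obtain ⟨l, hl, hl'⟩ := exists_between
    (max_lt hL (by linarith) : max 0 (Real.log C₁ - ε / 2) < Real.log C₁)
  obtain ⟨hl0, hlε⟩ := max_lt_iff.1 hl
  obtain ⟨n₀, D, ν, hn₀, hD, hν, hunit⟩ := hasUnit hl0 hl'
  filter_upwards [eventually_const_le (C := l * (3 + (n₀ + D))) (by positivity : 0 < ε / 4),
    eventually_const_le (C := 6 + 2 * (n₀ : ℝ)) (one_pos), eventually_ge_atTop 1] with d hd hd' hd1
  have hd1' : (1 : ℝ) ≤ d := by exact_mod_cast hd1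
  have hN := four_mul_le_N hd1
  have hK := sq_le_arnold_bound d
  have hA := @innerCount_le_A d
  set K := ((d + 1) / 2 - 1) * ((d + 1) / 2 - 2) / 2
  have hn₀K : n₀ ≤ 4 * K := by
    have h1 : (n₀ : ℝ) ≤ 4 * K := by nlinarith
    exact_mod_cast h1
  set R := (4 * K - n₀) / D with hR
  have hR1 : R * D ≤ 4 * K - n₀ := Nat.div_mul_le_self _ _
  have hR2 : 4 * K - n₀ < R * D + D := Nat.lt_div_mul_add hD
  have hRν : R * ν ≤ K := by
    have h1 : 4 * (R * ν) ≤ R * D := by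
      calc 4 * (R * ν) = R * (4 * ν) := by ring
        _ ≤ R * D := Nat.mul_le_mul_left _ hν
    omega
  have h1 := hA (n := n₀ + R * D) (e := 1 + R * ν) (o := R * ν) (by omega) (by omega)
    (by omega) hRν
  have h2 : Real.exp (l * (R * D)) ≤ A d := (hunit R).trans (by exact_mod_cast h1)
  have h3 := Real.log_le_log (Real.exp_pos _) h2
  rw [Real.log_exp] at h3
  refine le_trans ?_ h3
  have h4 : (4 : ℝ) * K ≤ R * D + D + n₀ := by
    have : 4 * K ≤ R * D + D + n₀ := by omega
    exact_mod_cast this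
  have h5 : l * ((d : ℝ) ^ 2 / 2 - 3 * d - (n₀ + D)) ≤ l * (R * D) :=
    mul_le_mul_of_nonneg_left (by linarith) hl0.le
  refine le_trans ?_ h5
  have h6 : l * (3 + (n₀ + D)) * d ≤ ε / 4 * d * d := mul_le_mul_of_nonneg_right hd (by positivity)
  have h7 : l * (3 * d + (n₀ + D)) ≤ l * (3 + (n₀ + D)) * d := by
    have h8 : (n₀ + D : ℝ) ≤ (n₀ + D) * d := le_mul_of_one_le_right (by positivity) hd1'
    have := mul_le_mul_of_nonneg_left h8 hl0.le
    linarith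
  nlinarith [mul_nonneg (by linarith : 0 ≤ l - (Real.log C₁ - ε / 2)) (sq_nonneg (d : ℝ))]

end RootedTrees

theorem theorem13 :
    ((2.9193800 : ℝ) ≤ PlaneTrees.C₁ ∧ PlaneTrees.C₁ < (2.9193801 : ℝ)) ∧
      PlaneTrees.ExpEquivalent (fun d : ℕ => (PlaneTrees.A d : ℝ))
        (fun d : ℕ => PlaneTrees.C₁ ^ ((d : ℝ) ^ 2 / 2)) := by
  refine ⟨RootedTrees.C₁_bounds, ?_⟩
  have hL := RootedTrees.log_C₁_pos
  have hC : 0 < PlaneTrees.C₁ := by linarith [RootedTrees.C₁_bounds.1]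
  refine isLittleO_iff.2 fun c hc => ?_
  filter_upwards [RootedTrees.eventually_log_A_le (mul_pos hc hL),
    RootedTrees.eventually_le_log_A (mul_pos hc hL)] with d h1 h2
  simp only [Pi.sub_apply]
  rw [Real.log_rpow hC, Real.norm_eq_abs, Real.norm_of_nonneg (by positivity), abs_le]
  constructor <;> linarith
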